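/- For integers $k,m$, let $J_{k,m}$ denote the complex vector space of weak Jacobi forms of weight $k$ and index $m$ for $SL_2(\mathbf{Z})$ (without character), i.e. of holomorphic functions $\varphi(\tau,z)$ on $\mathbf{H}\times\mathbf{C}$, where $\mathbf{H}$ is the upper half-plane, such that (1) $\varphi\left(\frac{a\tau+b}{c\tau+d},\frac{z}{c\tau+d}\right)=(c\tau+d)^k e^{2\pi i m\frac{cz^2}{c\tau+d}}\varphi(\tau,z)$ for all $\begin{pmatrix}a&b\\c&d\end{pmatrix}\in SL_2(\mathbf{Z})$; (2) $\varphi(\tau,z+\lambda\tau+\mu)=e^{-2\pi i m(\lambda^2\tau+2\lambda z)}\varphi(\tau,z)$ for all $\lambda,\mu\in\mathbf{Z}$; (3) $\varphi$ has a Fourier expansion $\varphi(\tau,z)=\sum_{n\ge 0}\sum_{r\in\mathbf{Z}}c(n,r)q^n y^r$ with $q=e^{2\pi i\tau}$, $y=e^{2\pi i z}$, absolutely convergent for all $(\tau,z)\in\mathbf{H}\times\mathbf{C}$ (only nonnegative powers of $q$ occur). Let $J_{0,*}=\bigoplus_{m\in\mathbf{Z}}J_{0,m}$ be the ring of weak Jacobi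 forms of weight zero, graded by the index $m$, with multiplication induced by the product of functions. **Proposition 4.1.** The ring $J_{0,*}$ is freely generated over $\mathbf{C}$ by three elements of degrees $1$, $2$ and $3$ respectively. That is, there are $\varphi_1\in J_{0,1}$, $\varphi_2\in J_{0,2}$ and $\varphi_3\in J_{0,3}$ which are algebraically independent over $\mathbf{C}$ in $J_{0,*}$ and generate $J_{0,*}$ as a $\mathbf{C}$-algebra. -/

import Mathlib

open scoped UpperHalfPlane MatrixGroups DirectSum

noncomputable section

/-- The function `e(x) = exp(2πix)`. -/
def expTwoPiI (x : ℂ) : ℂ := Complex.exp (2 * Real.pi * Complex.I * x)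

/-- `φ(τ, z)` is a weak Jacobi form of weight `k` and index `m` for `SL(2, ℤ)`, without character:
a holomorphic function on `ℍ × ℂ` with the transformation laws of the Jacobi group, in whose
Fourier expansion `∑ c(n, r) q ^ n y ^ r`, where `q = e(τ)` and `y = e(z)`, only nonnegative
powers of `q` appear. -/
structure IsWeakJacobiForm (k m : ℤ) (φ : ℍ × ℂ → ℂ) : Prop where
  holomorphic : DifferentiableOn ℂ
    (fun p : ℂ × ℂ => φ (UpperHalfPlane.ofComplex p.1, p.2)) {p | 0 < p.1.im}
  modular : ∀ (γ : SL(2, ℤ)) (τ : ℍ) (z : ℂ),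
    φ (γ • τ, z / ((γ 1 0 : ℂ) * τ + (γ 1 1 : ℂ))) =
      ((γ 1 0 : ℂ) * τ + (γ 1 1 : ℂ)) ^ k *
        expTwoPiI (m * ((γ 1 0 : ℂ) * z ^ 2 / ((γ 1 0 : ℂ) * τ + (γ 1 1 : ℂ)))) * φ (τ, z)
  elliptic : ∀ (a b : ℤ) (τ : ℍ) (z : ℂ),
    φ (τ, z + a * τ + b) = expTwoPiI (-m * (a ^ 2 * τ + 2 * a * z)) * φ (τ, z)
  fourier : ∃ c : ℕ × ℤ → ℂ, ∀ (τ : ℍ) (z : ℂ),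
    HasSum (fun p : ℕ × ℤ => c p * expTwoPiI (p.1 * τ + p.2 * z)) (φ (τ, z))

lemma expTwoPiI_zero : expTwoPiI 0 = 1 := by simp [expTwoPiI]

lemma expTwoPiI_add (x y : ℂ) : expTwoPiI (x + y) = expTwoPiI x * expTwoPiI y := by
  simp [expTwoPiI, mul_add, Complex.exp_add]

lemma hasSum_fiberwise {α β : Type} (s : α → β) (u : α → ℂ) (F : β → ℂ) {a : ℂ}
    (h : HasSum (fun x => u x * F (s x)) a) :
    HasSum (fun p => (∑' x : {x // s x = p}, u x) * F p) a := by
  have h2 := (Equiv.sigmaFiberEquiv s).hasSum_iff.mpr h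
  have h3 := h2.sigma (fun p => (h2.summable.sigma_factor p).hasSum)
  convert h3 using 2 with p
  rw [← tsum_mul_right]
  exact tsum_congr fun x => by
    simp only [Function.comp_apply, Equiv.sigmaFiberEquiv_apply, x.2]

lemma hasSum_mul_prod {α β : Type} {u : α → ℂ} {v : β → ℂ} {a b : ℂ} (hu : HasSum u a)
    (hv : HasSum v b) : HasSum (fun x : α × β => u x.1 * v x.2) (a * b) :=
  hu.mul hv (summable_mul_of_summable_norm hu.summable.norm hv.summable.norm)

namespace IsWeakJacobiForm

lemma zero (k m : ℤ) : IsWeakJacobiForm k m 0 where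
  holomorphic := by simp
  modular := by simp
  elliptic := by simp
  fourier := ⟨0, fun τ z => by simp⟩

lemma add {k m : ℤ} {f g : ℍ × ℂ → ℂ} (hf : IsWeakJacobiForm k m f)
    (hg : IsWeakJacobiForm k m g) : IsWeakJacobiForm k m (f + g) where
  holomorphic := hf.holomorphic.add hg.holomorphic
  modular γ τ z := by simp only [Pi.add_apply, hf.modular, hg.modular, mul_add]
  elliptic a b τ z := by simp only [Pi.add_apply, hf.elliptic, hg.elliptic, mul_add]
  fourier := by
    obtain ⟨c, hc⟩ := hf.fourier
    obtain ⟨d, hd⟩ := hg.fourier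
    exact ⟨c + d, fun τ z => by simpa [add_mul] using (hc τ z).add (hd τ z)⟩

lemma smul {k m : ℤ} {f : ℍ × ℂ → ℂ} (t : ℂ) (hf : IsWeakJacobiForm k m f) :
    IsWeakJacobiForm k m (t • f) where
  holomorphic := hf.holomorphic.const_smul t
  modular γ τ z := by simp only [Pi.smul_apply, hf.modular, smul_eq_mul]; ring
  elliptic a b τ z := by simp only [Pi.smul_apply, hf.elliptic, smul_eq_mul]; ring
  fourier := by
    obtain ⟨c, hc⟩ := hf.fourier
    exact ⟨t • c, fun τ z => by simpa [mul_assoc] using (hc τ z).mul_left t⟩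

lemma one : IsWeakJacobiForm 0 0 1 where
  holomorphic := by simp
  modular := by simp [expTwoPiI_zero]
  elliptic := by simp [expTwoPiI_zero]
  fourier := by
    refine ⟨Pi.single (0, 0) 1, fun τ z => ?_⟩
    have h := hasSum_single (f := fun p : ℕ × ℤ =>
      (Pi.single (0, 0) 1 : ℕ × ℤ → ℂ) p * expTwoPiI (p.1 * τ + p.2 * z)) (0, 0)
      (fun p hp => by simp [Pi.single_eq_of_ne hp])
    simpa [expTwoPiI_zero] using h

lemma mul {k l m n : ℤ} {f g : ℍ × ℂ → ℂ} (hf : IsWeakJacobiForm k m f)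
    (hg : IsWeakJacobiForm l n g) : IsWeakJacobiForm (k + l) (m + n) (f * g) where
  holomorphic := hf.holomorphic.mul hg.holomorphic
  modular γ τ z := by
    have h0 : (γ 1 0 : ℂ) * τ + (γ 1 1 : ℂ) ≠ 0 := by
      simpa [UpperHalfPlane.denom] using UpperHalfPlane.denom_ne_zero (γ : GL (Fin 2) ℝ) τ
    simp only [Pi.mul_apply, hf.modular, hg.modular, zpow_add₀ h0, Int.cast_add, add_mul,
      expTwoPiI_add]
    ring
  elliptic a b τ z := by
    simp only [Pi.mul_apply, hf.elliptic, hg.elliptic, Int.cast_add, neg_add, add_mul,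
      expTwoPiI_add]
    ring
  fourier := by
    obtain ⟨c, hc⟩ := hf.fourier
    obtain ⟨d, hd⟩ := hg.fourier
    let s : (ℕ × ℤ) × (ℕ × ℤ) → ℕ × ℤ := fun x => x.1 + x.2
    refine ⟨fun p => ∑' x : {x // s x = p}, c x.1.1 * d x.1.2, fun τ z => ?_⟩
    let F : ℕ × ℤ → ℂ := fun p => expTwoPiI (p.1 * τ + p.2 * z)
    have hF (p q : ℕ × ℤ) : F (p + q) = F p * F q := by
      simp only [F, ← expTwoPiI_add]
      congr 1
      simp
      ring
    have hprod : HasSum (fun x : (ℕ × ℤ) × (ℕ × ℤ) => c x.1 * d x.2 * F (s x))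
        (f (τ, z) * g (τ, z)) := by
      have h := hasSum_mul_prod (hc τ z) (hd τ z)
      convert h using 2 with x
      change c x.1 * d x.2 * F (x.1 + x.2) = c x.1 * F x.1 * (d x.2 * F x.2)
      rw [hF]
      ring
    exact hasSum_fiberwise s (fun x => c x.1 * d x.2) F hprod

end IsWeakJacobiForm

/-- The complex vector space of weak Jacobi forms of weight `k` and index `m`. -/
def weakJacobiForm (k m : ℤ) : Submodule ℂ (ℍ × ℂ → ℂ) where
  carrier := {φ | IsWeakJacobiForm k m φ}
  zero_mem' := .zero k m
  add_mem' := .add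
  smul_mem' t _ := .smul t

/-- The weak Jacobi forms of weight zero of all (integral) indices form a graded ring. -/
instance weakJacobiForm_gradedMonoid :
    SetLike.GradedMonoid (fun m : ℤ => weakJacobiForm 0 m) where
  one_mem := IsWeakJacobiForm.one
  mul_mem _ _ _ _ hf hg := IsWeakJacobiForm.mul hf hg

/-- The ring of weak Jacobi forms of weight zero, graded by the index; multiplication is
induced by the pointwise product of functions. -/
abbrev WeakJacobiRing : Type := ⨁ m : ℤ, weakJacobiForm 0 m

/-- A weak Jacobi form of weight zero and index `m`, as a homogeneous element of degree `m` of the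
ring of weak Jacobi forms of weight zero. -/
abbrev WeakJacobiRing.of (m : ℤ) (φ : weakJacobiForm 0 m) : WeakJacobiRing :=
  DirectSum.of (fun m : ℤ => weakJacobiForm 0 m) m φ

end

/-! Write A for `phiNegTwo` (weight -2, index 1, A = z² + ...) and B for `phiZero` (weight 0, index
1, B = 1 + ...). The three generators are B, E₄A² and E₆A³.

Generation. For fixed τ a form of weight 0 is an even theta-like function of z, and A is theta
squared up to a nowhere vanishing factor, with double zeros exactly on the lattice. An even function
of index m vanishing at 0 is therefore divisible by A, with a quotient of index m - 1
(`IsElliptic.exists_eq_phiNegTwo_mul`); in index 0 only constants remain, by Liouville. Subtracting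
a multiple of B^d and dividing by A, repeatedly, gives φ = ∑ f_j A^j B^(d-j) with unique
coefficients f_j(τ) (`exists_decomposition`, `decomposition_unique`). Uniqueness forces f_j to
transform in weight 2j, and the Fourier expansion makes it holomorphic at the cusp. So f_j is a
polynomial in E₄ and E₆ (`modularForm_mem_eisensteinSpan`), and E₄^x E₆^y A^j with 2x + 3y = j
equals (E₄A²)^x (E₆A³)^y.

Modularity of A and B is obtained from the same division principle and the normalization of their
Taylor expansions at z = 0 (`phi_slash`), with no transformation law of theta or eta. Here B/A is
the Weierstrass function ℘.

Independence. Evaluating at (τ, z), with degree m weighted by t^m, makes a relation vanish at all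
points (tB, t²E₄A², t³E₆A³). Since B/A and E₄³/E₆² take infinitely many values, the relation is zero
(`mvPolynomial_eq_zero_of_eval_phi`). -/

open scoped Manifold ModularForm

noncomputable section

/-! ### The exponential, `q`-expansions and Fourier expansions. -/

lemma expTwoPiI_ne_zero (x : ℂ) : expTwoPiI x ≠ 0 := Complex.exp_ne_zero _

lemma expTwoPiI_neg (x : ℂ) : expTwoPiI (-x) = (expTwoPiI x)⁻¹ := by
  simp [expTwoPiI, Complex.exp_neg]

lemma expTwoPiI_sub (x y : ℂ) : expTwoPiI (x - y) = expTwoPiI x / expTwoPiI y := by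
  rw [sub_eq_add_neg, expTwoPiI_add, expTwoPiI_neg, div_eq_mul_inv]

lemma expTwoPiI_nat_mul (n : ℕ) (x : ℂ) : expTwoPiI (n * x) = expTwoPiI x ^ n := by
  rw [expTwoPiI, expTwoPiI, ← Complex.exp_nat_mul]
  ring_nf

lemma expTwoPiI_int (n : ℤ) : expTwoPiI n = 1 := by
  rw [expTwoPiI, mul_comm]
  exact Complex.exp_int_mul_two_pi_mul_I n

lemma expTwoPiI_one : expTwoPiI 1 = 1 := by simpa using expTwoPiI_int 1

lemma expTwoPiI_half : expTwoPiI (1 / 2) = -1 := by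
  rw [expTwoPiI, ← Complex.exp_pi_mul_I]
  ring_nf

lemma norm_expTwoPiI (x : ℂ) : ‖expTwoPiI x‖ = Real.exp (-(2 * Real.pi * x.im)) := by
  simp [expTwoPiI, Complex.norm_exp]

lemma norm_expTwoPiI_lt_one (τ : ℍ) : ‖expTwoPiI τ‖ < 1 := by
  rw [norm_expTwoPiI, Real.exp_lt_one_iff]
  have := τ.im_pos
  have := Real.pi_pos
  simp only [UpperHalfPlane.coe_im, Left.neg_neg_iff]
  positivity

lemma differentiable_expTwoPiI : Differentiable ℂ expTwoPiI := by
  unfold expTwoPiI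
  fun_prop

lemma hasDerivAt_expTwoPiI (x : ℂ) :
    HasDerivAt expTwoPiI (2 * Real.pi * Complex.I * expTwoPiI x) x := by
  unfold expTwoPiI
  simpa [mul_comm] using ((hasDerivAt_id x).const_mul (2 * Real.pi * Complex.I)).cexp

lemma exists_expTwoPiI_eq {q : ℂ} (hq : ‖q‖ < 1) (h0 : q ≠ 0) : ∃ τ : ℍ, expTwoPiI τ = q := by
  refine ⟨⟨Function.Periodic.invQParam 1 q,
    Function.Periodic.im_invQParam_pos_of_norm_lt_one one_pos hq h0⟩, ?_⟩
  have := Function.Periodic.qParam_right_inv one_ne_zero h0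
  simpa [Function.Periodic.qParam, expTwoPiI] using this

/-- A function on the upper half-plane is a holomorphic function of `q = e(τ)` on the
unit disc. -/
def HasQExpansion (f : ℍ → ℂ) : Prop :=
  ∃ F : ℂ → ℂ, DifferentiableOn ℂ F (Metric.ball 0 1) ∧ ∀ τ : ℍ, f τ = F (expTwoPiI τ)

/-- A function on `ℍ × ℂ` has a Fourier expansion in `q = e(τ)` and `y = e(z)`, with only
nonnegative powers of `q`. -/
def HasFourier (φ : ℍ × ℂ → ℂ) : Prop :=
  ∃ c : ℕ × ℤ → ℂ, ∀ (τ : ℍ) (z : ℂ),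
    HasSum (fun p : ℕ × ℤ => c p * expTwoPiI (p.1 * τ + p.2 * z)) (φ (τ, z))

lemma expTwoPiI_mem_ball (τ : ℍ) : expTwoPiI τ ∈ Metric.ball (0 : ℂ) 1 := by
  simpa using norm_expTwoPiI_lt_one τ

namespace HasQExpansion

variable {f g : ℍ → ℂ}

lemma const (t : ℂ) : HasQExpansion fun _ => t := ⟨fun _ => t, by fun_prop, fun _ => rfl⟩

lemma mul (hf : HasQExpansion f) (hg : HasQExpansion g) : HasQExpansion (fun τ => f τ * g τ) := by
  obtain ⟨F, hF, hf⟩ := hf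
  obtain ⟨G, hG, hg⟩ := hg
  exact ⟨fun q => F q * G q, hF.mul hG, fun τ => by simp [hf, hg]⟩

lemma sub (hf : HasQExpansion f) (hg : HasQExpansion g) : HasQExpansion (fun τ => f τ - g τ) := by
  obtain ⟨F, hF, hf⟩ := hf
  obtain ⟨G, hG, hg⟩ := hg
  exact ⟨fun q => F q - G q, hF.sub hG, fun τ => by simp [hf, hg]⟩

lemma mdifferentiable (hf : HasQExpansion f) : MDiff f := by
  obtain ⟨F, hF, hf⟩ := hf
  rw [UpperHalfPlane.mdifferentiable_iff]
  refine DifferentiableOn.congr (f := fun z => F (expTwoPiI z)) (hF.comp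
    differentiable_expTwoPiI.differentiableOn fun z hz => expTwoPiI_mem_ball ⟨z, hz⟩) fun z hz => ?_
  simp [hf, UpperHalfPlane.ofComplex_apply_of_im_pos (show 0 < z.im from hz)]

lemma isBoundedAtImInfty (hf : HasQExpansion f) : UpperHalfPlane.IsBoundedAtImInfty f := by
  obtain ⟨F, hF, hf⟩ := hf
  have hc : ContinuousAt F 0 :=
    (hF.differentiableAt (Metric.ball_mem_nhds _ one_pos)).continuousAt
  have ht := hc.tendsto.comp (UpperHalfPlane.qParam_tendsto_atImInfty one_pos)
  have : f = F ∘ fun τ : ℍ => Function.Periodic.qParam 1 τ := by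
    ext τ
    simp [hf, Function.Periodic.qParam, expTwoPiI]
  rw [this]
  exact ht.isBigO_one ℝ

end HasQExpansion

namespace HasFourier

variable {φ ψ : ℍ × ℂ → ℂ}

lemma of_hasSum {α : Type} (s : α → ℕ × ℤ) (u : α → ℂ)
    (h : ∀ (τ : ℍ) (z : ℂ),
      HasSum (fun x => u x * expTwoPiI ((s x).1 * τ + (s x).2 * z)) (φ (τ, z))) :
    HasFourier φ :=
  ⟨fun p => ∑' x : {x // s x = p}, u x, fun τ z =>
    hasSum_fiberwise s u (fun p => expTwoPiI (p.1 * τ + p.2 * z)) (h τ z)⟩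

lemma add (hφ : HasFourier φ) (hψ : HasFourier ψ) : HasFourier (fun p => φ p + ψ p) := by
  obtain ⟨c, hc⟩ := hφ
  obtain ⟨d, hd⟩ := hψ
  exact ⟨c + d, fun τ z => by simpa [add_mul] using (hc τ z).add (hd τ z)⟩

lemma mul (hφ : HasFourier φ) (hψ : HasFourier ψ) : HasFourier (fun p => φ p * ψ p) := by
  obtain ⟨c, hc⟩ := hφ
  obtain ⟨d, hd⟩ := hψ
  refine of_hasSum (fun x : (ℕ × ℤ) × (ℕ × ℤ) => x.1 + x.2) (fun x => c x.1 * d x.2) fun τ z => ?_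
  convert! hasSum_mul_prod (hc τ z) (hd τ z) using 2 with x
  rw [mul_mul_mul_comm, ← expTwoPiI_add]
  simp only [Prod.fst_add, Prod.snd_add, Nat.cast_add, Int.cast_add]
  ring_nf

lemma of_hasQExpansion {f : ℍ → ℂ} (hf : HasQExpansion f) : HasFourier (fun p => f p.1) := by
  obtain ⟨F, hF, hf⟩ := hf
  refine of_hasSum (fun n : ℕ => (n, 0))
    (fun n => (n.factorial : ℂ)⁻¹ * iteratedDeriv n F 0) fun τ z => ?_
  have := Complex.hasSum_taylorSeries_on_ball hF (expTwoPiI_mem_ball τ)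
  simp only [hf]
  convert! this using 2 with n
  simp only [Int.cast_zero, zero_mul, add_zero, expTwoPiI_nat_mul, sub_zero, smul_eq_mul]
  ring

lemma const (t : ℂ) : HasFourier (fun _ => t) := of_hasQExpansion (.const t)

lemma sub (hφ : HasFourier φ) (hψ : HasFourier ψ) : HasFourier (fun p => φ p - ψ p) := by
  simpa [sub_eq_add_neg] using hφ.add ((const (-1)).mul hψ)

lemma pow (hφ : HasFourier φ) (n : ℕ) : HasFourier (fun p => φ p ^ n) := by
  induction n with
  | zero => simpa using const 1
  | succ n ih => simpa [pow_succ] using ih.mul hφ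

lemma expTwoPiI_neg_snd : HasFourier fun p => expTwoPiI (-p.2) :=
  of_hasSum (fun _ : Unit => (0, -1)) (fun _ => 1) fun τ z => by
    simp

lemma add_half (hφ : HasFourier φ) : HasFourier fun p => φ (p.1, p.2 + 1 / 2) := by
  obtain ⟨c, hc⟩ := hφ
  refine ⟨fun p => c p * expTwoPiI (p.2 * (1 / 2)), fun τ z => ?_⟩
  convert! hc τ (z + 1 / 2) using 2 with p
  rw [mul_assoc, ← expTwoPiI_add]
  ring_nf

lemma eval_zero (hφ : HasFourier φ) : HasQExpansion fun τ => φ (τ, 0) := by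
  obtain ⟨c, hc⟩ := hφ
  have h (τ : ℍ) : HasSum (fun n : ℕ => (∑' x : {x : ℕ × ℤ // x.1 = n}, c x) * expTwoPiI τ ^ n)
      (φ (τ, 0)) := by
    refine hasSum_fiberwise (fun x : ℕ × ℤ => x.1) c (fun n => expTwoPiI τ ^ n) ?_
    simpa [expTwoPiI_nat_mul] using hc τ 0
  set d : ℕ → ℂ := fun n => ∑' x : {x : ℕ × ℤ // x.1 = n}, c x
  refine ⟨fun q => ∑' n, d n * q ^ n, fun q hq => ?_, fun τ => (h τ).tsum_eq.symm⟩
  obtain ⟨r, hqr, hr⟩ := exists_between (mem_ball_zero_iff.mp hq)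
  have hr0 : 0 < r := (norm_nonneg q).trans_lt hqr
  have hrn : ‖(r : ℂ)‖ = r := by simp [hr0.le]
  -- A real r in (0, 1) is itself some e(τ), so the given convergence at that τ dominates the series
  -- on the disc of radius r.
  obtain ⟨τ, hτ⟩ := exists_expTwoPiI_eq (q := r) (by rwa [hrn]) (by exact_mod_cast hr0.ne')
  have hs : Summable fun n => ‖d n‖ * r ^ n := by
    simpa [hτ, abs_of_pos hr0] using (h τ).summable.norm
  refine ((Complex.differentiableOn_tsum_of_summable_norm hs (U := Metric.ball 0 r)
    (fun n => by fun_prop) Metric.isOpen_ball fun n w hw => ?_).differentiableAt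
      (Metric.isOpen_ball.mem_nhds (by simpa using hqr))).differentiableWithinAt
  rw [norm_mul, norm_pow]
  gcongr
  exact (mem_ball_zero_iff.mp hw).le

/-- The Fréchet derivative of a term of a Fourier expansion. -/
def termFDeriv (c : ℕ × ℤ → ℂ) (i : ℕ × ℤ) (p : ℂ × ℂ) : ℂ × ℂ →L[ℂ] ℂ :=
  (c i * (2 * Real.pi * Complex.I * expTwoPiI (i.1 * p.1 + i.2 * p.2))) •
    ((i.1 : ℂ) • ContinuousLinearMap.fst ℂ ℂ ℂ + (i.2 : ℂ) • ContinuousLinearMap.snd ℂ ℂ ℂ)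

lemma hasFDerivAt_term (c : ℕ × ℤ → ℂ) (i : ℕ × ℤ) (p : ℂ × ℂ) :
    HasFDerivAt (fun p : ℂ × ℂ => c i * expTwoPiI (i.1 * p.1 + i.2 * p.2))
      (termFDeriv c i p) p := by
  have h1 : HasFDerivAt (fun p : ℂ × ℂ => (i.1 * p.1 + i.2 * p.2 : ℂ))
      ((i.1 : ℂ) • ContinuousLinearMap.fst ℂ ℂ ℂ + (i.2 : ℂ) • ContinuousLinearMap.snd ℂ ℂ ℂ) p :=
    (hasFDerivAt_fst.const_mul _).add (hasFDerivAt_snd.const_mul _)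
  have h2 := ((hasDerivAt_expTwoPiI (i.1 * p.1 + i.2 * p.2)).comp_hasFDerivAt p h1).const_mul (c i)
  rw [smul_smul] at h2
  exact h2

/-- Differentiation costs a factor n + |r|, absorbed by lowering the height T to T / 2 and widening
S to S + 1. The two terms on the right cover the two signs of r; both come from the original series
at single points, which gives a summable majorant. -/
lemma norm_termFDeriv_le (c : ℕ × ℤ → ℂ) (i : ℕ × ℤ) {p : ℂ × ℂ} {S T : ℝ} (hT : 0 < T)
    (h1 : T < p.1.im) (h2 : |p.2.im| < S) :
    ‖termFDeriv c i p‖ ≤ 2 * Real.pi * ((Real.pi * T)⁻¹ + 1) *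
      (‖c i * expTwoPiI (i.1 * ((T / 2 : ℝ) * Complex.I) + i.2 * ((S + 1 : ℝ) * Complex.I))‖ +
      ‖c i * expTwoPiI (i.1 * ((T / 2 : ℝ) * Complex.I) + i.2 * (-(S + 1 : ℝ) * Complex.I))‖) := by
  obtain ⟨n, r⟩ := i
  have hpi := Real.pi_pos
  have hlin : ‖((n : ℂ) • ContinuousLinearMap.fst ℂ ℂ ℂ + (r : ℂ) • ContinuousLinearMap.snd ℂ ℂ ℂ)‖
      ≤ n + |(r : ℝ)| := by
    refine (norm_add_le _ _).trans (add_le_add ?_ ?_)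
    · rw [norm_smul, Complex.norm_natCast]
      exact mul_le_of_le_one_right (by positivity) (ContinuousLinearMap.norm_fst_le ..)
    · rw [norm_smul, Complex.norm_intCast]
      exact mul_le_of_le_one_right (by positivity) (ContinuousLinearMap.norm_snd_le ..)
  have hn : (n : ℝ) ≤ (Real.pi * T)⁻¹ * Real.exp (n * (Real.pi * T)) := by
    rw [inv_mul_eq_div, le_div_iff₀ (by positivity)]
    linarith [Real.add_one_le_exp (n * (Real.pi * T))]
  have hr : |(r : ℝ)| ≤ Real.exp (2 * Real.pi * |(r : ℝ)|) := by
    have : |(r : ℝ)| ≤ 2 * Real.pi * |(r : ℝ)| :=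
      le_mul_of_one_le_left (abs_nonneg _) (by linarith [Real.pi_gt_three])
    linarith [Real.add_one_le_exp (2 * Real.pi * |(r : ℝ)|)]
  have hnr : n + |(r : ℝ)| ≤ ((Real.pi * T)⁻¹ + 1) *
      (Real.exp (n * (Real.pi * T)) * Real.exp (2 * Real.pi * |(r : ℝ)|)) := by
    have e1 : 1 ≤ Real.exp (n * (Real.pi * T)) := Real.one_le_exp (by positivity)
    have e2 : 1 ≤ Real.exp (2 * Real.pi * |(r : ℝ)|) := Real.one_le_exp (by positivity)
    rw [add_mul, one_mul]
    refine add_le_add (hn.trans ?_) (hr.trans ?_)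
    · exact mul_le_mul_of_nonneg_left (le_mul_of_one_le_right (by positivity) e2) (by positivity)
    · exact le_mul_of_one_le_left (by positivity) e1
  have hexp : Real.exp (-(2 * Real.pi * (n * p.1.im + r * p.2.im))) ≤
      Real.exp (-(2 * Real.pi * (n * T))) * Real.exp (2 * Real.pi * |(r : ℝ)| * S) := by
    rw [← Real.exp_add, Real.exp_le_exp]
    have a1 : (n : ℝ) * T ≤ n * p.1.im := by gcongr
    have a2 : -(r * p.2.im) ≤ |(r : ℝ)| * S := by
      refine (neg_le_abs _).trans ?_
      rw [abs_mul]
      gcongr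
    nlinarith
  have habs : Real.exp (2 * Real.pi * |(r : ℝ)| * (S + 1)) ≤
      Real.exp (-(2 * Real.pi * (r * (S + 1)))) + Real.exp (-(2 * Real.pi * (r * -(S + 1)))) := by
    rcases abs_cases (r : ℝ) with ⟨h, -⟩ | ⟨h, -⟩
    · rw [h, show -(2 * Real.pi * (r * -(S + 1))) = 2 * Real.pi * r * (S + 1) by ring]
      linarith [Real.exp_pos (-(2 * Real.pi * (r * (S + 1))))]
    · rw [h, show -(2 * Real.pi * (r * (S + 1))) = 2 * Real.pi * -r * (S + 1) by ring]
      linarith [Real.exp_pos (-(2 * Real.pi * (r * -(S + 1))))]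
  rw [termFDeriv, norm_smul, norm_mul, norm_mul _ (expTwoPiI _), norm_mul (c _), norm_mul (c _)]
  simp only [norm_expTwoPiI]
  have i1 : ((n : ℂ) * p.1 + r * p.2).im = n * p.1.im + r * p.2.im := by simp
  have i2 : ((n : ℂ) * ((T / 2 : ℝ) * Complex.I) + r * ((S + 1 : ℝ) * Complex.I)).im =
      n * (T / 2) + r * (S + 1) := by simp
  have i3 : ((n : ℂ) * ((T / 2 : ℝ) * Complex.I) + r * (-(S + 1 : ℝ) * Complex.I)).im =
      n * (T / 2) + r * -(S + 1) := by simp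
  rw [i1, i2, i3]
  have hc : ‖(2 * Real.pi * Complex.I : ℂ)‖ = 2 * Real.pi := by
    simp [abs_of_pos hpi]
  rw [hc]
  calc ‖c (n, r)‖ * (2 * Real.pi * Real.exp (-(2 * Real.pi * (n * p.1.im + r * p.2.im)))) * _
      ≤ ‖c (n, r)‖ * (2 * Real.pi * (Real.exp (-(2 * Real.pi * (n * T))) *
          Real.exp (2 * Real.pi * |(r : ℝ)| * S))) * (((Real.pi * T)⁻¹ + 1) *
      (Real.exp (n * (Real.pi * T)) * Real.exp (2 * Real.pi * |(r : ℝ)|))) := by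
        gcongr
        exact hlin.trans hnr
    _ = 2 * Real.pi * ((Real.pi * T)⁻¹ + 1) * (‖c (n, r)‖ * (Real.exp (-(2 * Real.pi *
          (n * (T / 2)))) * Real.exp (2 * Real.pi * |(r : ℝ)| * (S + 1)))) := by
        rw [show -(2 * Real.pi * (n * (T / 2))) = -(2 * Real.pi * (n * T)) + n * (Real.pi * T) by
          ring, show 2 * Real.pi * |(r : ℝ)| * (S + 1) = 2 * Real.pi * |(r : ℝ)| * S +
          2 * Real.pi * |(r : ℝ)| by ring, Real.exp_add, Real.exp_add]
        ring
    _ ≤ _ := by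
        have hsplit (x : ℝ) : Real.exp (-(2 * Real.pi * (n * (T / 2) + r * x))) =
            Real.exp (-(2 * Real.pi * (n * (T / 2)))) * Real.exp (-(2 * Real.pi * (r * x))) := by
          rw [← Real.exp_add]
          ring_nf
        rw [hsplit, hsplit, ← mul_add, ← mul_add]
        gcongr

lemma hasFDerivAt_tsum {c : ℕ × ℤ → ℂ} (hc : ∀ (τ : ℍ) (z : ℂ),
      Summable (fun p : ℕ × ℤ => c p * expTwoPiI (p.1 * τ + p.2 * z))) (τ : ℍ) (z : ℂ) :
    Summable (fun i => termFDeriv c i (τ, z)) ∧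
    HasFDerivAt (fun p : ℂ × ℂ => ∑' i : ℕ × ℤ, c i * expTwoPiI (i.1 * p.1 + i.2 * p.2))
      (∑' i, termFDeriv c i (τ, z)) (τ, z) := by
  obtain ⟨T, hT, hTτ⟩ := exists_between τ.im_pos
  obtain ⟨S, hS⟩ := exists_gt |z.im|
  have hT' : 0 < ((T / 2 : ℝ) * Complex.I).im := by simpa using hT
  have hu := (((hc ⟨_, hT'⟩ ((S + 1 : ℝ) * Complex.I)).norm.add
    (hc ⟨_, hT'⟩ (-(S + 1 : ℝ) * Complex.I)).norm).mul_left
      (2 * Real.pi * ((Real.pi * T)⁻¹ + 1)))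
  have hzs : ((τ : ℂ), z) ∈ {w : ℂ | T < w.im} ×ˢ {w : ℂ | |w.im| < S} := ⟨hTτ, hS⟩
  refine ⟨.of_norm_bounded hu fun i => norm_termFDeriv_le c i hT hTτ hS, ?_⟩
  refine hasFDerivAt_tsum_of_isPreconnected hu (s := {w : ℂ | T < w.im} ×ˢ {w : ℂ | |w.im| < S})
    ?_ ?_ (fun i p _ => hasFDerivAt_term c i p)
    (fun i p hp => norm_termFDeriv_le c i hT hp.1 hp.2) hzs (hc τ z) hzs
  · exact (isOpen_lt continuous_const Complex.continuous_im).prod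
      (isOpen_lt Complex.continuous_im.abs continuous_const)
  · refine (Convex.prod ?_ ?_).isPreconnected
    · exact convex_halfSpace_im_gt T
    · have : {w : ℂ | |w.im| < S} = {w : ℂ | -S < w.im} ∩ {w : ℂ | w.im < S} := by
        ext w
        exact abs_lt (a := w.im) (b := S)
      rw [this]
      exact (convex_halfSpace_im_gt _).inter (convex_halfSpace_im_lt _)

lemma differentiableOn (hφ : HasFourier φ) : DifferentiableOn ℂ
    (fun p : ℂ × ℂ => φ (UpperHalfPlane.ofComplex p.1, p.2)) {p | 0 < p.1.im} := by
  obtain ⟨c, hc⟩ := hφ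
  have h : DifferentiableOn ℂ (fun p : ℂ × ℂ =>
      ∑' i : ℕ × ℤ, c i * expTwoPiI (i.1 * p.1 + i.2 * p.2)) {p | 0 < p.1.im} := fun p hp =>
    (hasFDerivAt_tsum (fun τ z => (hc τ z).summable) ⟨p.1, hp⟩
      p.2).2.differentiableAt.differentiableWithinAt
  refine h.congr fun p hp => ?_
  rw [UpperHalfPlane.ofComplex_apply_of_im_pos hp]
  exact (hc ⟨p.1, hp⟩ p.2).tsum_eq.symm

lemma exists_hasDerivAt (hφ : HasFourier φ) : ∃ ψ, HasFourier ψ ∧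
    ∀ (τ : ℍ) (z : ℂ), HasDerivAt (fun z => φ (τ, z)) (ψ (τ, z)) z := by
  obtain ⟨c, hc⟩ := hφ
  have h := hasFDerivAt_tsum (fun τ z => (hc τ z).summable)
  refine ⟨fun p => (∑' i, termFDeriv c i (p.1, p.2)) (0, 1),
    ⟨fun i => c i * (2 * Real.pi * Complex.I) * i.2, fun τ z => ?_⟩, fun τ z => ?_⟩
  · have := (h τ z).1.hasSum.mapL (ContinuousLinearMap.apply ℂ ℂ ((0, 1) : ℂ × ℂ))
    simp only [ContinuousLinearMap.apply_apply] at this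
    convert! this using 2 with i
    simp [termFDeriv]
    ring
  · have h1 : HasDerivAt (fun z => ((τ : ℂ), z)) (0, 1) z :=
      (hasDerivAt_const z _).prodMk (hasDerivAt_id z)
    refine ((h τ z).2.comp_hasDerivAt z h1).congr_of_eventuallyEq (.of_forall fun w => ?_)
    exact (hc τ w).tsum_eq.symm

lemma differentiable (hφ : HasFourier φ) (τ : ℍ) : Differentiable ℂ fun z => φ (τ, z) := by
  obtain ⟨ψ, -, h⟩ := hφ.exists_hasDerivAt
  exact fun z => (h τ z).differentiableAt

lemma iteratedDeriv (hφ : HasFourier φ) (N : ℕ) :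
    HasFourier fun p => iteratedDeriv N (fun z => φ (p.1, z)) p.2 := by
  induction N generalizing φ with
  | zero => simpa using hφ
  | succ N ih =>
    obtain ⟨ψ, hψ, h⟩ := hφ.exists_hasDerivAt
    convert! ih hψ using 2 with p
    rw [iteratedDeriv_succ', funext fun z => (h p.1 z).deriv]

lemma iteratedDeriv_zero (hφ : HasFourier φ) (N : ℕ) :
    HasQExpansion fun τ => _root_.iteratedDeriv N (fun z => φ (τ, z)) 0 :=
  (hφ.iteratedDeriv N).eval_zero

end HasFourier

/-! ### The `q`-Pochhammer symbol and the theta function. -/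

/-- The infinite `q`-Pochhammer symbol `∏ (1 - q ^ n x)`. -/
def qPoch (q x : ℂ) : ℂ := ∏' n : ℕ, (1 - q ^ n * x)

section qPoch

variable {q : ℂ} (hq : ‖q‖ < 1) (x : ℂ)
include hq

lemma summable_norm_qPoch : Summable fun n : ℕ => ‖-(q ^ n * x)‖ := by
  simpa using (summable_geometric_of_lt_one (norm_nonneg q) hq).mul_right ‖x‖

lemma multipliable_qPoch : Multipliable fun n : ℕ => 1 - q ^ n * x := by
  simpa [sub_eq_add_neg] using multipliable_one_add_of_summable (summable_norm_qPoch hq x)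

lemma qPoch_eq_one_sub_mul : qPoch q x = (1 - x) * qPoch q (q * x) := by
  have h := multipliable_qPoch hq (q * x)
  simp only [← mul_assoc, ← pow_succ] at h
  rw [qPoch, tprod_eq_zero_mul' (f := fun n => 1 - q ^ n * x) h]
  simp [qPoch, ← mul_assoc, ← pow_succ]

lemma exists_pow_mul_eq_one_of_qPoch_eq_zero (h : qPoch q x = 0) : ∃ n : ℕ, q ^ n * x = 1 := by
  by_contra! hn
  refine tprod_one_add_ne_zero_of_summable (f := fun n => -(q ^ n * x)) (fun n => ?_)
    (summable_norm_qPoch hq x) (by simpa [qPoch, sub_eq_add_neg] using h)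
  rw [← sub_eq_add_neg, sub_ne_zero]
  exact (hn n).symm

lemma qPoch_self_ne_zero : qPoch q q ≠ 0 := fun h => by
  obtain ⟨n, hn⟩ := exists_pow_mul_eq_one_of_qPoch_eq_zero hq q h
  have := pow_lt_one₀ (norm_nonneg q) hq n.succ_ne_zero
  rw [← norm_pow, pow_succ, hn, norm_one] at this
  exact lt_irrefl _ this

lemma qPoch_neg_mul_self : qPoch q (-q) * qPoch q q = qPoch (q ^ 2) (q ^ 2) := by
  rw [qPoch, qPoch, qPoch, ← (multipliable_qPoch hq (-q)).tprod_mul (multipliable_qPoch hq q)]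
  exact tprod_congr fun n => by ring

end qPoch

lemma differentiableOn_qPoch_self :
    DifferentiableOn ℂ (fun q => qPoch q q) (Metric.ball 0 1) := by
  simpa [qPoch, ← pow_succ] using ModularForm.differentiableOn_tprod_one_sub_pow

/-- Expanding the product gives a sum over finite sets of indices, each contributing one monomial
with sign (-1)^card. -/
lemma HasFourier.tprod_one_sub (s : ℕ → ℕ × ℤ) (hs : ∀ (τ : ℍ) (z : ℂ),
      Summable fun n => ‖expTwoPiI ((s n).1 * τ + (s n).2 * z)‖) :
    HasFourier fun p => ∏' n, (1 - expTwoPiI ((s n).1 * p.1 + (s n).2 * p.2)) := by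
  refine HasFourier.of_hasSum (fun S : Finset ℕ => ∑ n ∈ S, s n) (fun S => (-1) ^ S.card)
    fun τ z => ?_
  have h : Summable (fun S : Finset ℕ =>
      ∏ n ∈ S, -expTwoPiI ((s n).1 * τ + (s n).2 * z)) :=
    summable_finsetProd_of_summable_norm (by simpa using hs τ z)
  have h2 := h.hasSum
  rw [← tprod_one_add h] at h2
  simp only [sub_eq_add_neg]
  convert! h2 using 2 with S
  induction S using Finset.induction_on with
  | empty => simp [expTwoPiI_zero]
  | insert n S hn ih =>
    rw [Finset.prod_insert hn, ← ih, Finset.sum_insert hn, Finset.card_insert_of_notMem hn, pow_succ]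
    simp only [Prod.fst_add, Prod.snd_add, Nat.cast_add, Int.cast_add, add_mul, expTwoPiI_add]
    ring

lemma hasFourier_qPoch : HasFourier fun p => qPoch (expTwoPiI p.1) (expTwoPiI p.2) := by
  convert! HasFourier.tprod_one_sub (fun n => (n, 1)) fun τ z => ?_ using 2 with p
  · simp [qPoch, expTwoPiI_add, expTwoPiI_nat_mul]
  · simpa [expTwoPiI_add, expTwoPiI_nat_mul] using
      summable_norm_qPoch (norm_expTwoPiI_lt_one τ) (expTwoPiI z)

lemma hasFourier_qPoch_sub :
    HasFourier fun p => qPoch (expTwoPiI p.1) (expTwoPiI (p.1 - p.2)) := by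
  have h (τ : ℍ) (z : ℂ) (n : ℕ) : expTwoPiI (((n + 1 : ℕ) : ℂ) * τ + ((-1 : ℤ) : ℂ) * z) =
      expTwoPiI τ ^ n * expTwoPiI (τ - z) := by
    rw [← expTwoPiI_nat_mul, ← expTwoPiI_add]
    push_cast
    ring_nf
  convert! HasFourier.tprod_one_sub (fun n => (n + 1, -1)) fun τ z => ?_ using 2 with p
  · simp only [qPoch, h]
  · simpa only [h, norm_neg] using
      summable_norm_qPoch (norm_expTwoPiI_lt_one τ) (expTwoPiI (τ - z))

/-- The Jacobi theta function `∏ (1 - q ^ n y) (1 - q ^ (n + 1) y⁻¹)`. -/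
def theta (p : ℍ × ℂ) : ℂ :=
  qPoch (expTwoPiI p.1) (expTwoPiI p.2) * qPoch (expTwoPiI p.1) (expTwoPiI (p.1 - p.2))

lemma hasFourier_theta : HasFourier theta := hasFourier_qPoch.mul hasFourier_qPoch_sub

lemma expTwoPiI_eq_one {x : ℂ} (h : expTwoPiI x = 1) : ∃ n : ℤ, x = n := by
  obtain ⟨n, hn⟩ := Complex.exp_eq_one_iff.mp h
  refine ⟨n, mul_right_cancel₀ Complex.two_pi_I_ne_zero ?_⟩
  rw [← hn, mul_comm]

section theta

variable (τ : ℍ) (z : ℂ)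

lemma theta_add_one : theta (τ, z + 1) = theta (τ, z) := by
  simp [theta, expTwoPiI_add, expTwoPiI_sub, expTwoPiI_one]

/-- Once the factor 1 - y is split off, the remaining product is symmetric under y ↦ y⁻¹, and 1 -
y⁻¹ = -y⁻¹(1 - y). -/
lemma theta_neg : theta (τ, -z) = -expTwoPiI (-z) * theta (τ, z) := by
  have hq := norm_expTwoPiI_lt_one τ
  have hy := expTwoPiI_ne_zero z
  simp only [theta, sub_neg_eq_add]
  rw [qPoch_eq_one_sub_mul hq (expTwoPiI (-z)), qPoch_eq_one_sub_mul hq (expTwoPiI z),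
    ← expTwoPiI_add, ← expTwoPiI_add, ← sub_eq_add_neg, expTwoPiI_neg]
  field_simp
  ring

/-- The two Pochhammer factors of theta at z + τ are those at -z in the other order. -/
lemma theta_add_coe : theta (τ, z + τ) = -expTwoPiI (-z) * theta (τ, z) := by
  rw [← theta_neg, theta, theta, mul_comm]
  ring_nf

lemma theta_zero : theta (τ, 0) = 0 := by
  rw [theta, expTwoPiI_zero, qPoch_eq_one_sub_mul (norm_expTwoPiI_lt_one τ) 1]
  simp

/-- This exhibits the normalizing constant of `thetaEven` as a zero-free holomorphic function of q.
-/
lemma theta_half : theta (τ, 1 / 2) =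
    2 * (qPoch (expTwoPiI τ ^ 2) (expTwoPiI τ ^ 2) / qPoch (expTwoPiI τ) (expTwoPiI τ)) ^ 2 := by
  have hq := norm_expTwoPiI_lt_one τ
  have h0 := qPoch_self_ne_zero hq
  rw [theta, qPoch_eq_one_sub_mul hq (expTwoPiI (1 / 2)), ← qPoch_neg_mul_self hq, expTwoPiI_sub,
    expTwoPiI_half]
  field_simp
  ring_nf

lemma hasDerivAt_theta_zero : HasDerivAt (fun z => theta (τ, z))
    (-(2 * Real.pi * Complex.I) * qPoch (expTwoPiI τ) (expTwoPiI τ) ^ 2) 0 := by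
  have hq := norm_expTwoPiI_lt_one τ
  have hP : DifferentiableAt ℂ (fun z : ℂ => qPoch (expTwoPiI τ) (expTwoPiI (τ + z)) *
      qPoch (expTwoPiI τ) (expTwoPiI (τ - z))) 0 :=
    ((hasFourier_qPoch.differentiable τ).comp (g := fun z => qPoch (expTwoPiI τ) (expTwoPiI z))
      (f := fun z : ℂ => τ + z) (by fun_prop)).differentiableAt.mul
      (hasFourier_qPoch_sub.differentiable τ).differentiableAt
  have h := ((hasDerivAt_expTwoPiI 0).const_sub 1).mul hP.hasDerivAt
  convert! h using 1
  · ext z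
    simp only [theta, Pi.mul_apply]
    rw [qPoch_eq_one_sub_mul hq (expTwoPiI z), expTwoPiI_add]
    ring
  · simp [expTwoPiI_zero]
    ring

lemma exists_eq_of_theta_eq_zero (h : theta (τ, z) = 0) : ∃ a b : ℤ, z = a * τ + b := by
  have hq := norm_expTwoPiI_lt_one τ
  rcases mul_eq_zero.mp h with h | h
  · obtain ⟨n, hn⟩ := exists_pow_mul_eq_one_of_qPoch_eq_zero hq _ h
    rw [← expTwoPiI_nat_mul, ← expTwoPiI_add] at hn
    obtain ⟨b, hb⟩ := expTwoPiI_eq_one hn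
    exact ⟨-n, b, by push_cast; linear_combination hb⟩
  · obtain ⟨n, hn⟩ := exists_pow_mul_eq_one_of_qPoch_eq_zero hq _ h
    rw [← expTwoPiI_nat_mul, ← expTwoPiI_add] at hn
    obtain ⟨b, hb⟩ := expTwoPiI_eq_one hn
    simp only at hb
    exact ⟨n + 1, -b, by push_cast; linear_combination -hb⟩

end theta

/-! ### Entire functions: cancellation and Taylor factors. -/

lemma eq_of_mul_eq_mul_of_countable {u p q : ℂ → ℂ} (hu : {z | u z = 0}.Countable)
    (hp : Continuous p) (hq : Continuous q) (h : ∀ z, u z * p z = u z * q z) (z : ℂ) :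
    p z = q z := by
  refine congrFun (hp.ext_on (hu.dense_compl ℂ) hq fun w hw => ?_) z
  exact mul_left_cancel₀ hw (h w)

lemma eq_of_pow_mul_eq_pow_mul (n : ℕ) {p q : ℂ → ℂ} (hp : Continuous p) (hq : Continuous q)
    (h : ∀ z, z ^ n * p z = z ^ n * q z) (z : ℂ) : p z = q z :=
  eq_of_mul_eq_mul_of_countable (u := fun z => z ^ n)
    ((Set.countable_singleton (0 : ℂ)).mono fun _ hz => eq_zero_of_pow_eq_zero hz) hp hq h z

lemma deriv_zero_of_even {f : ℂ → ℂ} (h : ∀ z, f (-z) = f z) : deriv f 0 = 0 := by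
  have h1 := deriv_comp_neg f 0
  rw [funext h, neg_zero] at h1
  simpa [CharZero.eq_neg_self_iff] using h1

lemma Differentiable.dslope {f : ℂ → ℂ} (hf : Differentiable ℂ f) (c : ℂ) :
    Differentiable ℂ (dslope f c) := by
  rw [← differentiableOn_univ] at hf ⊢
  exact (Complex.differentiableOn_dslope Filter.univ_mem).mpr hf

lemma exists_eq_mul_of_zero {f : ℂ → ℂ} (hf : Differentiable ℂ f) (h0 : f 0 = 0) :
    ∃ g, Differentiable ℂ g ∧ g 0 = deriv f 0 ∧ ∀ z, f z = z * g z :=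
  ⟨dslope f 0, hf.dslope 0, dslope_same f 0, fun z => by
    simpa [h0] using (sub_smul_dslope f 0 z).symm⟩

lemma exists_eq_sq_mul_of_even {f : ℂ → ℂ} (hf : Differentiable ℂ f) (he : ∀ z, f (-z) = f z)
    (h0 : f 0 = 0) : ∃ g, Differentiable ℂ g ∧ ∀ z, f z = z ^ 2 * g z := by
  obtain ⟨g, hg, hg0, hfg⟩ := exists_eq_mul_of_zero hf h0
  obtain ⟨k, hk, -, hgk⟩ := exists_eq_mul_of_zero hg (hg0.trans (deriv_zero_of_even he))
  exact ⟨k, hk, fun z => by rw [hfg, hgk]; ring⟩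

lemma iteratedDeriv_pow_mul_zero (N : ℕ) {k : ℂ → ℂ} (hk : Differentiable ℂ k) :
    iteratedDeriv N (fun z => z ^ N * k z) 0 = N.factorial * k 0 := by
  induction N generalizing k with
  | zero => simp
  | succ N ih =>
    have hk' : Differentiable ℂ (deriv k) := fun z => (hk.analyticAt z).deriv.differentiableAt
    have h : deriv (fun z => z ^ (N + 1) * k z) =
        fun z => z ^ N * ((N + 1) * k z + z * deriv k z) := by
      ext z
      have := ((hasDerivAt_id z).pow (N + 1)).mul (hk z).hasDerivAt
      refine (this.deriv).trans ?_
      simp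
      ring
    rw [iteratedDeriv_succ', h, ih (by fun_prop)]
    simp [Nat.factorial_succ]
    ring

/-! ### Even elliptic functions of a given index. -/

/-- An even entire function which transforms like a Jacobi form of index `m` under the lattice
`ℤτ + ℤ`. -/
structure IsElliptic (τ : ℍ) (m : ℤ) (f : ℂ → ℂ) : Prop where
  differentiable : Differentiable ℂ f
  even : ∀ z, f (-z) = f z
  add_one : ∀ z, f (z + 1) = f z
  add_coe : ∀ z, f (z + τ) = expTwoPiI (-m * (τ + 2 * z)) * f z

/-- The translations preserving `P` form a subgroup of ℂ, so it suffices that it contains 1 and τ.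
-/
lemma lattice_induction (τ : ℍ) {P : ℂ → Prop} (h0 : P 0) (h1 : ∀ z, P (z + 1) ↔ P z)
    (hτ : ∀ z, P (z + τ) ↔ P z) (a b : ℤ) : P (a * τ + b) := by
  let H : AddSubgroup ℂ :=
    { carrier := {w | ∀ z, P (z + w) ↔ P z}
      zero_mem' := by simp
      add_mem' := fun {u v} hu hv z => by rw [← add_assoc, hv, hu]
      neg_mem' := fun {u} hu z => by rw [← hu (z + -u), neg_add_cancel_right] }
  have hm : (a : ℂ) * τ + b ∈ H := by
    have ha : a • (τ : ℂ) ∈ H := H.zsmul_mem hτ a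
    have hb : b • (1 : ℂ) ∈ H := H.zsmul_mem h1 b
    simpa using H.add_mem ha hb
  simpa using (hm 0).mpr h0

namespace IsElliptic

variable {τ : ℍ} {m n : ℤ} {f g : ℂ → ℂ}

lemma const (t : ℂ) : IsElliptic τ 0 fun _ => t :=
  ⟨by fun_prop, by simp, by simp, by simp [expTwoPiI_zero]⟩

lemma sub (hf : IsElliptic τ m f) (hg : IsElliptic τ m g) :
    IsElliptic τ m fun z => f z - g z :=
  ⟨hf.1.sub hg.1, fun z => by simp only [hf.2, hg.2], fun z => by simp only [hf.3, hg.3],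
    fun z => by simp only [hf.4, hg.4]; ring⟩

lemma add (hf : IsElliptic τ m f) (hg : IsElliptic τ m g) :
    IsElliptic τ m fun z => f z + g z :=
  ⟨hf.1.add hg.1, fun z => by simp only [hf.2, hg.2], fun z => by simp only [hf.3, hg.3],
    fun z => by simp only [hf.4, hg.4]; ring⟩

lemma const_mul (hf : IsElliptic τ m f) (t : ℂ) : IsElliptic τ m fun z => t * f z :=
  ⟨hf.1.const_mul t, fun z => by simp only [hf.2], fun z => by simp only [hf.3],
    fun z => by simp only [hf.4]; ring⟩

lemma mul (hf : IsElliptic τ m f) (hg : IsElliptic τ n g) :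
    IsElliptic τ (m + n) fun z => f z * g z :=
  ⟨hf.1.mul hg.1, fun z => by simp only [hf.2, hg.2], fun z => by simp only [hf.3, hg.3],
    fun z => by
      simp only [hf.4, hg.4, Int.cast_add, neg_add, add_mul, expTwoPiI_add]
      ring⟩

lemma pow (hf : IsElliptic τ m f) (k : ℕ) : IsElliptic τ (k * m) fun z => f z ^ k := by
  induction k with
  | zero => simpa using const 1
  | succ k ih => simpa [pow_succ, add_mul] using ih.mul hf

lemma add_int (hf : IsElliptic τ m f) (z : ℂ) (b : ℤ) : f (z + b) = f z := by
  have h : Function.Periodic f 1 := hf.add_one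
  simpa using h.int_mul b z

lemma add_lattice (hf : IsElliptic τ m f) (z : ℂ) (a b : ℤ) :
    f (z + a * τ + b) = expTwoPiI (-m * (a ^ 2 * τ + 2 * a * z)) * f z := by
  rw [hf.add_int]
  induction a using Int.induction_on with
  | zero => simp [expTwoPiI_zero]
  | succ a ih =>
    rw [show z + ((a + 1 : ℤ) : ℂ) * τ = z + (a : ℤ) * τ + τ by push_cast; ring, hf.add_coe, ih,
      ← mul_assoc, ← expTwoPiI_add]
    congr 2
    push_cast
    ring
  | pred a ih =>
    have h := hf.add_coe (z + ((-a - 1 : ℤ) : ℂ) * τ)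
    rw [show z + ((-a - 1 : ℤ) : ℂ) * τ + τ = z + ((-a : ℤ) : ℂ) * τ by push_cast; ring, ih] at h
    refine mul_left_cancel₀ (expTwoPiI_ne_zero
      (-m * (τ + 2 * (z + ((-a - 1 : ℤ) : ℂ) * τ)))) ?_
    rw [← h, ← mul_assoc, ← expTwoPiI_add]
    congr 2
    push_cast
    ring

lemma zero_lattice (hf : IsElliptic τ m f) (h0 : f 0 = 0) (a b : ℤ) : f (a * τ + b) = 0 := by
  simpa [h0] using hf.add_lattice 0 a b

/-- In index 0 both periods are genuine, so all values are taken on the compact fundamental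
parallelogram and Liouville applies. -/
lemma eq_const (hf : IsElliptic τ 0 f) (z w : ℂ) : f z = f w := by
  refine hf.differentiable.apply_eq_apply_of_bounded ?_ z w
  have hK : IsCompact ((fun p : ℝ × ℝ => f (p.1 * τ + p.2)) ''
      (Set.Icc (0 : ℝ) 1 ×ˢ Set.Icc (0 : ℝ) 1)) := by
    refine (isCompact_Icc.prod isCompact_Icc).image ?_
    exact hf.differentiable.continuous.comp (by fun_prop)
  refine hK.isBounded.subset ?_
  rintro _ ⟨z, rfl⟩
  set x := z.im / τ.im
  set y := z.re - x * τ.re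
  have hz : z = x * τ + y := by
    apply Complex.ext
    · simp [y]
    · simp [x, τ.im_ne_zero]
  refine ⟨(Int.fract x, Int.fract y), ⟨⟨Int.fract_nonneg x, (Int.fract_lt_one x).le⟩,
    ⟨Int.fract_nonneg y, (Int.fract_lt_one y).le⟩⟩, ?_⟩
  have h := hf.add_lattice (Int.fract x * τ + Int.fract y) ⌊x⌋ ⌊y⌋
  simp only [Int.cast_zero, neg_zero, zero_mul, expTwoPiI_zero, one_mul] at h
  refine h.symm.trans (congrArg f ?_)
  have hx : (x : ℂ) = Int.fract x + ⌊x⌋ := by exact_mod_cast (Int.fract_add_floor x).symm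
  have hy : (y : ℂ) = Int.fract y + ⌊y⌋ := by exact_mod_cast (Int.fract_add_floor y).symm
  linear_combination -hz - τ * hx - hy

/-- The slash action on elliptic functions of a given index. -/
lemma slash {γ : SL(2, ℤ)} (hf : IsElliptic (γ • τ) m f) :
    IsElliptic τ m fun z => f (z / (γ 1 0 * τ + γ 1 1)) *
      expTwoPiI (-m * (γ 1 0 * z ^ 2 / (γ 1 0 * τ + γ 1 1))) := by
  have hj : (γ 1 0 : ℂ) * τ + γ 1 1 ≠ 0 := by
    simpa [UpperHalfPlane.denom] using UpperHalfPlane.denom_ne_zero (γ : GL (Fin 2) ℝ) τ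
  have hτ : ((γ • τ : ℍ) : ℂ) = (γ 0 0 * τ + γ 0 1) / (γ 1 0 * τ + γ 1 1) := by
    simpa using UpperHalfPlane.coe_specialLinearGroup_apply γ τ
  have hdet : (γ 0 0 : ℂ) * γ 1 1 - γ 0 1 * γ 1 0 = 1 := by
    have := γ.det_coe
    rw [Matrix.det_fin_two] at this
    exact_mod_cast this
  -- The multiplier of the translation and the Gaussian factor are compared inside e(-m ·), where an
  -- integer discrepancy N is harmless.
  have key (z w : ℂ) (a b N : ℤ) (u v : ℂ)
      (h1 : w / (γ 1 0 * τ + γ 1 1) = z / (γ 1 0 * τ + γ 1 1) + a * (γ • τ : ℍ) + b)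
      (h2 : (a ^ 2 * (γ • τ : ℍ) + 2 * a * (z / (γ 1 0 * τ + γ 1 1)) + u : ℂ) = v + N) :
      f (w / (γ 1 0 * τ + γ 1 1)) * expTwoPiI (-m * u) =
        expTwoPiI (-m * v) * f (z / (γ 1 0 * τ + γ 1 1)) := by
    rw [h1, hf.add_lattice, mul_right_comm, ← expTwoPiI_add, ← mul_add, h2, mul_add, expTwoPiI_add,
      show -(m : ℂ) * N = (-m * N : ℤ) by push_cast; ring, expTwoPiI_int, mul_one]
  generalize (γ 0 0) = p at *
  generalize (γ 0 1) = q at *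
  generalize (γ 1 0) = r at *
  generalize (γ 1 1) = s at *
  have hd := hf.differentiable
  refine ⟨?_, fun z => ?_, fun z => ?_, fun z => ?_⟩
  · refine (hd.comp (g := f) (f := fun z : ℂ => z / (r * τ + s)) (by fun_prop)).mul
      (differentiable_expTwoPiI.comp (by fun_prop))
  · simp only [neg_div, hf.even, even_two, Even.neg_pow]
  · rw [mul_comm _ (expTwoPiI (-m * (r * z ^ 2 / (r * τ + s))))]
    -- With γ = (p, q; r, s), the new periods in the lattice of γτ are 1/(rτ + s) = -r·γτ + p and,
    -- below, τ/(rτ + s) = s·γτ - q.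
    refine key z (z + 1) (-r) p (p * r) _ _ ?_ ?_
    · rw [hτ]
      field_simp
      push_cast
      linear_combination -hdet
    · have hw := mul_inv_cancel₀ hj
      rw [hτ]
      simp only [div_eq_mul_inv]
      push_cast
      linear_combination -(r * (r * τ + s : ℂ)⁻¹) * hdet + p * r * hw
  · rw [← mul_assoc, mul_right_comm (expTwoPiI (-m * (τ + 2 * z))), ← expTwoPiI_add, ← mul_add]
    refine key z (z + τ) s (-q) (s * q) _ _ ?_ ?_
    · have hw := mul_inv_cancel₀ hj
      rw [hτ]
      simp only [div_eq_mul_inv]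
      push_cast
      linear_combination -((r * τ + s : ℂ)⁻¹ * τ) * hdet - q * hw
    · have hw := mul_inv_cancel₀ hj
      rw [hτ]
      simp only [div_eq_mul_inv]
      push_cast
      linear_combination ((r * τ + s : ℂ)⁻¹ * s * τ) * hdet + (2 * z + τ + s * q) * hw

end IsElliptic

/-! ### Division by theta. -/

section theta

variable (τ : ℍ)

lemma countable_theta_zeros : {z | theta (τ, z) = 0}.Countable := by
  refine (Set.countable_range fun p : ℤ × ℤ => (p.1 * τ + p.2 : ℂ)).mono fun z hz => ?_
  obtain ⟨a, b, h⟩ := exists_eq_of_theta_eq_zero τ z hz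
  exact ⟨(a, b), h.symm⟩

lemma differentiable_theta : Differentiable ℂ fun z => theta (τ, z) :=
  hasFourier_theta.differentiable τ

lemma deriv_theta_zero_ne_zero : deriv (fun z => theta (τ, z)) 0 ≠ 0 := by
  rw [(hasDerivAt_theta_zero τ).deriv]
  exact mul_ne_zero (neg_ne_zero.mpr Complex.two_pi_I_ne_zero)
    (pow_ne_zero _ (qPoch_self_ne_zero (norm_expTwoPiI_lt_one τ)))

/-- Simplicity of the zero at 0 is transported along the lattice. The induction carries the
vanishing as well, because the derivative picks up a mere nonzero factor under z ↦ z + τ only at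
zeros of theta. -/
lemma deriv_theta_ne_zero {z : ℂ} (h : theta (τ, z) = 0) :
    deriv (fun z => theta (τ, z)) z ≠ 0 := by
  obtain ⟨a, b, rfl⟩ := exists_eq_of_theta_eq_zero τ z h
  refine (lattice_induction τ
    (P := fun z => theta (τ, z) = 0 ∧ deriv (fun z => theta (τ, z)) z ≠ 0)
    ⟨theta_zero τ, deriv_theta_zero_ne_zero τ⟩ (fun z => ?_) (fun z => ?_) a b).2
  · rw [← deriv_comp_add_const (fun z => theta (τ, z)) 1 z]
    simp only [theta_add_one]
  · rw [← deriv_comp_add_const (fun z => theta (τ, z)) τ z]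
    simp only [theta_add_coe, mul_eq_zero, neg_eq_zero, expTwoPiI_ne_zero, false_or]
    refine and_congr_right fun hz => ?_
    have h1 : DifferentiableAt ℂ (fun z => -expTwoPiI (-z)) z :=
      (differentiable_expTwoPiI.comp differentiable_neg).neg z
    rw [deriv_fun_mul h1 (differentiable_theta τ z), hz]
    simp [expTwoPiI_ne_zero]

lemma exists_eq_theta_mul {f : ℂ → ℂ} (hf : Differentiable ℂ f)
    (h : ∀ z, theta (τ, z) = 0 → f z = 0) :
    ∃ g, Differentiable ℂ g ∧ ∀ z, f z = theta (τ, z) * g z := by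
  classical
  set t : ℂ → ℂ := fun z => theta (τ, z) with ht
  have htd : Differentiable ℂ t := differentiable_theta τ
  -- At a simple zero of theta the quotient of derivatives is the value removing the singularity.
  refine ⟨fun z => if t z = 0 then deriv f z / deriv t z else f z / t z, fun w => ?_, fun z => ?_⟩
  · by_cases hw : t w = 0
    · have h1 : dslope t w w ≠ 0 := by
        rw [dslope_same]
        exact deriv_theta_ne_zero τ hw
      have hd : DifferentiableAt ℂ (fun z => dslope f w z / dslope t w z) w :=
        (hf.dslope w w).div (htd.dslope w w) h1
      refine hd.congr_of_eventuallyEq ?_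
      filter_upwards [(htd.dslope w).continuous.continuousAt.eventually_ne h1] with z hz
      rcases eq_or_ne z w with rfl | hzw
      · simp [hw, dslope_same]
      · have e1 : t z = (z - w) * dslope t w z := by
          simpa [hw] using (sub_smul_dslope t w z).symm
        have e2 : f z = (z - w) * dslope f w z := by
          simpa [h w hw] using (sub_smul_dslope f w z).symm
        have hne : t z ≠ 0 := by
          rw [e1]
          exact mul_ne_zero (sub_ne_zero.mpr hzw) hz
        rw [if_neg hne, e1, e2, mul_div_mul_left _ _ (sub_ne_zero.mpr hzw)]
    · have hd : DifferentiableAt ℂ (fun z => f z / t z) w := (hf w).div (htd w) hw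
      refine hd.congr_of_eventuallyEq ?_
      filter_upwards [htd.continuous.continuousAt.eventually_ne hw] with z hz
      simp [hz]
  · by_cases hz : t z = 0
    · simp [ht ▸ hz, h z hz]
    · simp only [hz, if_false]
      exact (mul_div_cancel₀ (f z) hz).symm

end theta

/-! ### The two generators of index 1. -/

/-- The normalized weak Jacobi form of weight `-2` and index `1`. -/
def phiNegTwo (p : ℍ × ℂ) : ℂ :=
  ((-(2 * Real.pi * Complex.I) * qPoch (expTwoPiI p.1) (expTwoPiI p.1) ^ 2) ^ 2)⁻¹ *
    (expTwoPiI (-p.2) * theta p ^ 2)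

/-- A normalized even theta function of index `1`. -/
def thetaEven (p : ℍ × ℂ) : ℂ :=
  (theta (p.1, 1 / 2) ^ 2)⁻¹ * (expTwoPiI (-p.2) * theta (p.1, p.2 + 1 / 2) ^ 2)

/-- The difference of the Taylor coefficients of order `4` of `phiNegTwo` and of order `2` of
`thetaEven` at `z = 0`. -/
def phiZeroCoeff (τ : ℍ) : ℂ :=
  (Nat.factorial 4 : ℂ)⁻¹ * iteratedDeriv 4 (fun z => phiNegTwo (τ, z)) 0 -
    (Nat.factorial 2 : ℂ)⁻¹ * iteratedDeriv 2 (fun z => thetaEven (τ, z)) 0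

/-- The weak Jacobi form of weight `0` and index `1`, with value `1` at `z = 0`. -/
def phiZero (p : ℍ × ℂ) : ℂ := thetaEven p + phiZeroCoeff p.1 * phiNegTwo p

lemma hasFourier_phiNegTwo : HasFourier phiNegTwo := by
  refine (HasFourier.of_hasQExpansion (f := fun τ =>
    ((-(2 * Real.pi * Complex.I) * qPoch (expTwoPiI τ) (expTwoPiI τ) ^ 2) ^ 2)⁻¹)
    ⟨fun q => ((-(2 * Real.pi * Complex.I) * qPoch q q ^ 2) ^ 2)⁻¹, ?_, fun τ => rfl⟩).mul
    (HasFourier.expTwoPiI_neg_snd.mul (hasFourier_theta.pow 2))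
  refine (((differentiableOn_qPoch_self.fun_pow 2).const_mul _).fun_pow 2).fun_inv fun q hq => ?_
  exact pow_ne_zero _ (mul_ne_zero (neg_ne_zero.mpr Complex.two_pi_I_ne_zero)
    (pow_ne_zero _ (qPoch_self_ne_zero (mem_ball_zero_iff.mp hq))))

lemma hasFourier_thetaEven : HasFourier thetaEven := by
  have hball {q : ℂ} (hq : q ∈ Metric.ball (0 : ℂ) 1) : q ^ 2 ∈ Metric.ball (0 : ℂ) 1 := by
    rw [mem_ball_zero_iff] at hq ⊢
    rw [norm_pow]
    exact pow_lt_one₀ (norm_nonneg q) hq two_ne_zero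
  refine (HasFourier.of_hasQExpansion (f := fun τ => (theta (τ, 1 / 2) ^ 2)⁻¹)
    ⟨fun q => ((2 * (qPoch (q ^ 2) (q ^ 2) / qPoch q q) ^ 2) ^ 2)⁻¹, ?_, fun τ => ?_⟩).mul
    (HasFourier.expTwoPiI_neg_snd.mul (hasFourier_theta.add_half.pow 2))
  · refine (((((differentiableOn_qPoch_self.comp (f := fun q => q ^ 2) (by fun_prop)
      fun q hq => hball hq).div differentiableOn_qPoch_self fun q hq =>
      qPoch_self_ne_zero (mem_ball_zero_iff.mp hq)).fun_pow 2).const_mul 2).fun_pow 2).fun_inv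
      fun q hq => ?_
    exact pow_ne_zero _ (mul_ne_zero two_ne_zero (pow_ne_zero _ (div_ne_zero
      (qPoch_self_ne_zero (mem_ball_zero_iff.mp (hball hq)))
      (qPoch_self_ne_zero (mem_ball_zero_iff.mp hq)))))
  · simp only [theta_half]

lemma hasFourier_phiZero : HasFourier phiZero :=
  hasFourier_thetaEven.add ((HasFourier.of_hasQExpansion
    (((HasQExpansion.const _).mul (hasFourier_phiNegTwo.iteratedDeriv_zero 4)).sub
      ((HasQExpansion.const _).mul (hasFourier_thetaEven.iteratedDeriv_zero 2)))).mul
    hasFourier_phiNegTwo)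

section index_one

variable (τ : ℍ)

lemma isElliptic_phiNegTwo : IsElliptic τ 1 fun z => phiNegTwo (τ, z) := by
  refine ⟨hasFourier_phiNegTwo.differentiable τ, fun z => ?_, fun z => ?_, fun z => ?_⟩
  · have := expTwoPiI_ne_zero z
    simp only [phiNegTwo, theta_neg, expTwoPiI_neg, neg_neg]
    field_simp
  · simp only [phiNegTwo, theta_add_one, neg_add, expTwoPiI_add, expTwoPiI_neg, expTwoPiI_one]
    simp
  · have e : expTwoPiI (-(1 : ℤ) * (τ + 2 * z)) =
        expTwoPiI (-τ) * (expTwoPiI (-z) * expTwoPiI (-z)) := by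
      rw [← expTwoPiI_add, ← expTwoPiI_add]
      push_cast
      ring_nf
    simp only [phiNegTwo, theta_add_coe, neg_add, e, expTwoPiI_add]
    ring

lemma isElliptic_thetaEven : IsElliptic τ 1 fun z => thetaEven (τ, z) := by
  refine ⟨hasFourier_thetaEven.differentiable τ, fun z => ?_, fun z => ?_, fun z => ?_⟩
  · have h : theta (τ, -z + 1 / 2) = expTwoPiI (-z) * theta (τ, z + 1 / 2) := by
      rw [show -z + 1 / 2 = -(z + 1 / 2) + 1 by ring, theta_add_one, theta_neg, neg_add,
        expTwoPiI_add, expTwoPiI_neg (1 / 2), expTwoPiI_half]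
      ring
    have := expTwoPiI_ne_zero z
    simp only [thetaEven, h, expTwoPiI_neg, neg_neg]
    field_simp
  · simp only [thetaEven, add_right_comm z 1, theta_add_one, neg_add, expTwoPiI_add, expTwoPiI_neg,
      expTwoPiI_one]
    simp
  · have e : expTwoPiI (-(1 : ℤ) * (τ + 2 * z)) =
        expTwoPiI (-τ) * (expTwoPiI (-z) * expTwoPiI (-z)) := by
      rw [← expTwoPiI_add, ← expTwoPiI_add]
      push_cast
      ring_nf
    simp only [thetaEven, add_right_comm z (τ : ℂ), theta_add_coe, neg_add, e, expTwoPiI_add,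
      expTwoPiI_neg (1 / 2), expTwoPiI_half]
    ring

lemma isElliptic_phiZero : IsElliptic τ 1 fun z => phiZero (τ, z) :=
  (isElliptic_thetaEven τ).add ((isElliptic_phiNegTwo τ).const_mul (phiZeroCoeff τ))

lemma phiNegTwo_zero : phiNegTwo (τ, 0) = 0 := by simp [phiNegTwo, theta_zero]

lemma countable_phiNegTwo_zeros : {z | phiNegTwo (τ, z) = 0}.Countable := by
  refine (countable_theta_zeros τ).mono fun z hz => ?_
  simpa [phiNegTwo, expTwoPiI_ne_zero, qPoch_self_ne_zero (norm_expTwoPiI_lt_one τ),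
    Real.pi_ne_zero] using hz

lemma thetaEven_zero : thetaEven (τ, 0) = 1 := by
  have hq := norm_expTwoPiI_lt_one τ
  have h : theta (τ, 1 / 2) ≠ 0 := by
    rw [theta_half]
    refine mul_ne_zero two_ne_zero (pow_ne_zero _ (div_ne_zero (qPoch_self_ne_zero ?_)
      (qPoch_self_ne_zero hq)))
    rw [norm_pow]
    exact pow_lt_one₀ (norm_nonneg _) hq two_ne_zero
  simp only [thetaEven, neg_zero, expTwoPiI_zero, zero_add, one_mul]
  exact inv_mul_cancel₀ (pow_ne_zero 2 h)

lemma phiZero_zero : phiZero (τ, 0) = 1 := by simp [phiZero, phiNegTwo_zero, thetaEven_zero]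

/-- The Taylor expansions of the two generators of index `1` in `z` agree up to a factor `z ^ 2` and
terms of order `3`. -/
lemma exists_phiNegTwo_eq_phiZero_eq : ∃ h k : ℂ → ℂ, Differentiable ℂ h ∧ Differentiable ℂ k ∧
    h 0 = 1 ∧ (∀ z, phiNegTwo (τ, z) = z ^ 2 * h z) ∧ ∀ z, phiZero (τ, z) = h z + z ^ 3 * k z := by
  obtain ⟨t, ht, ht0, hθ⟩ := exists_eq_mul_of_zero (differentiable_theta τ) (theta_zero τ)
  set K := -(2 * Real.pi * Complex.I) * qPoch (expTwoPiI τ) (expTwoPiI τ) ^ 2 with hK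
  rw [(hasDerivAt_theta_zero τ).deriv] at ht0
  have hK0 : K ≠ 0 := by
    have := deriv_theta_zero_ne_zero τ
    rwa [(hasDerivAt_theta_zero τ).deriv] at this
  set h : ℂ → ℂ := fun z => (K ^ 2)⁻¹ * (expTwoPiI (-z) * t z ^ 2) with hh
  have hd : Differentiable ℂ h :=
    ((differentiable_expTwoPiI.comp differentiable_neg).mul (ht.pow 2)).const_mul _
  have hA (z : ℂ) : phiNegTwo (τ, z) = z ^ 2 * h z := by
    simp only [phiNegTwo, hθ, hh, ← hK]
    ring
  have hh0 : h 0 = 1 := by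
    simp only [hh, ht0, ← hK, neg_zero, expTwoPiI_zero, one_mul]
    exact inv_mul_cancel₀ (pow_ne_zero 2 hK0)
  have he : ∀ z, h (-z) = h z := by
    refine eq_of_pow_mul_eq_pow_mul 2 (hd.comp differentiable_neg).continuous hd.continuous
      fun z => ?_
    rw [← hA, ← (isElliptic_phiNegTwo τ).even, hA]
    simp
  obtain ⟨h2, hd2, hh2⟩ := exists_eq_sq_mul_of_even (hd.sub_const 1)
    (fun z => by simp only [he]) (by simp [hh0])
  obtain ⟨b, hb, hb2⟩ := exists_eq_sq_mul_of_even ((isElliptic_thetaEven τ).differentiable.sub_const 1)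
    (fun z => by simp only [(isElliptic_thetaEven τ).even]) (by simp [thetaEven_zero])
  have hh2' (z : ℂ) : h z = 1 + z ^ 2 * h2 z := by rw [← hh2]; ring
  have hb2' (z : ℂ) : thetaEven (τ, z) = 1 + z ^ 2 * b z := by rw [← hb2]; ring
  have i4 : iteratedDeriv 4 (fun z => phiNegTwo (τ, z)) 0 = Nat.factorial 4 * h2 0 := by
    have : (fun z => phiNegTwo (τ, z)) = (fun z => z ^ 2) + fun z => z ^ 4 * h2 z := by
      ext z
      simp only [hA, hh2', Pi.add_apply]
      ring
    rw [this, iteratedDeriv_add (by fun_prop)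
      (Differentiable.contDiff (by fun_prop)).contDiffAt, iteratedDeriv_pow_mul_zero 4 hd2]
    simp
  have i2 : iteratedDeriv 2 (fun z => thetaEven (τ, z)) 0 = Nat.factorial 2 * b 0 := by
    have : (fun z => thetaEven (τ, z)) = (fun _ => 1) + fun z => z ^ 2 * b z := by
      ext z
      simp only [hb2', Pi.add_apply]
    rw [this, iteratedDeriv_add (by fun_prop)
      (Differentiable.contDiff (by fun_prop)).contDiffAt, iteratedDeriv_pow_mul_zero 2 hb]
    simp [iteratedDeriv_const]
  -- This function is (`phiZero` - h) / z²; it vanishes at 0 exactly because `phiZeroCoeff` equals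
  -- h2 0 - b 0.
  obtain ⟨k, hk, -, hk2⟩ := exists_eq_mul_of_zero (f := fun z => b z + (h2 0 - b 0) * h z - h2 z)
    (by fun_prop) (by simp [hh0])
  refine ⟨h, k, hd, hk, hh0, hA, fun z => ?_⟩
  have f4 : (Nat.factorial 4 : ℂ) ≠ 0 := by exact_mod_cast Nat.factorial_ne_zero 4
  have f2 : (Nat.factorial 2 : ℂ) ≠ 0 := by exact_mod_cast Nat.factorial_ne_zero 2
  have hc : phiZeroCoeff τ = h2 0 - b 0 := by
    rw [phiZeroCoeff, i4, i2, inv_mul_cancel_left₀ f4, inv_mul_cancel_left₀ f2]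
  rw [phiZero, hc, hb2', hA]
  linear_combination z ^ 2 * hk2 z - hh2' z

end index_one

/-! ### Division by `phiNegTwo`. -/

namespace IsElliptic

variable {τ : ℍ} {m : ℤ} {f : ℂ → ℂ}

lemma eq_of_phiNegTwo_mul_eq {p q : ℂ → ℂ} (hp : Continuous p) (hq : Continuous q)
    (h : ∀ z, phiNegTwo (τ, z) * p z = phiNegTwo (τ, z) * q z) (z : ℂ) : p z = q z :=
  eq_of_mul_eq_mul_of_countable (countable_phiNegTwo_zeros τ) hp hq h z

/-- Quasi-periodicity spreads the zero at 0 over the lattice, so theta divides f. Evenness kills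
f'(0), so the quotient vanishes at 0 and again on the lattice: theta divides twice. The
transformation laws of the quotient follow by cancelling `phiNegTwo`. -/
lemma exists_eq_phiNegTwo_mul (hf : IsElliptic τ m f) (h0 : f 0 = 0) :
    ∃ g, IsElliptic τ (m - 1) g ∧ ∀ z, f z = phiNegTwo (τ, z) * g z := by
  have hθ0 := deriv_theta_zero_ne_zero τ
  obtain ⟨g₁, hg₁, hfg₁⟩ := exists_eq_theta_mul τ hf.differentiable fun z hz => by
    obtain ⟨a, b, rfl⟩ := exists_eq_of_theta_eq_zero τ z hz
    exact hf.zero_lattice h0 a b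
  have hg0 : g₁ 0 = 0 := by
    have h := deriv_zero_of_even hf.even
    rw [funext hfg₁, deriv_fun_mul (differentiable_theta τ 0) (hg₁ 0), theta_zero] at h
    simpa [hθ0] using h
  have h1 : ∀ z, g₁ (z + 1) = g₁ z := by
    refine eq_of_mul_eq_mul_of_countable (countable_theta_zeros τ)
      (hg₁.continuous.comp (by fun_prop)) hg₁.continuous fun z => ?_
    rw [← hfg₁, ← hf.add_one, hfg₁, theta_add_one]
  have hτ : ∀ z, g₁ (z + τ) = -expTwoPiI z * expTwoPiI (-m * (τ + 2 * z)) * g₁ z := by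
    refine eq_of_mul_eq_mul_of_countable (countable_theta_zeros τ)
      (hg₁.continuous.comp (by fun_prop)) ?_ fun z => ?_
    · exact (differentiable_expTwoPiI.neg.mul
        (differentiable_expTwoPiI.comp (by fun_prop))).continuous.mul hg₁.continuous
    · have h := hf.add_coe z
      rw [hfg₁, hfg₁, theta_add_coe, expTwoPiI_neg] at h
      have := expTwoPiI_ne_zero z
      generalize expTwoPiI (-m * (τ + 2 * z)) = e at h ⊢
      field_simp at h
      linear_combination -h
  obtain ⟨g₂, hg₂, hg₁₂⟩ := exists_eq_theta_mul τ hg₁ fun z hz => by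
    obtain ⟨a, b, rfl⟩ := exists_eq_of_theta_eq_zero τ z hz
    refine lattice_induction τ (P := fun z => g₁ z = 0) hg0 (fun z => by rw [h1])
      (fun z => ?_) a b
    simp [hτ, expTwoPiI_ne_zero]
  set K := (-(2 * Real.pi * Complex.I) * qPoch (expTwoPiI τ) (expTwoPiI τ) ^ 2) ^ 2
  have hK : K ≠ 0 := by
    rw [(hasDerivAt_theta_zero τ).deriv] at hθ0
    exact pow_ne_zero 2 hθ0
  set g : ℂ → ℂ := fun z => K * expTwoPiI z * g₂ z with hgdef
  have hg : Differentiable ℂ g := (differentiable_expTwoPiI.const_mul K).mul hg₂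
  have hfg (z : ℂ) : f z = phiNegTwo (τ, z) * g z := by
    have := expTwoPiI_ne_zero z
    have hA : phiNegTwo (τ, z) = K⁻¹ * (expTwoPiI (-z) * theta (τ, z) ^ 2) := rfl
    rw [hfg₁, hg₁₂, hA, hgdef, expTwoPiI_neg]
    field_simp
  have ha := isElliptic_phiNegTwo τ
  refine ⟨g, ⟨hg, ?_, ?_, ?_⟩, hfg⟩
  · refine eq_of_phiNegTwo_mul_eq (τ := τ) (hg.comp differentiable_neg).continuous hg.continuous fun z => ?_
    rw [← hfg, ← hf.even, hfg, ha.even]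
  · refine eq_of_phiNegTwo_mul_eq (τ := τ) (hg.continuous.comp (by fun_prop)) hg.continuous fun z => ?_
    rw [← hfg, ← hf.add_one, hfg, ha.add_one]
  · refine eq_of_phiNegTwo_mul_eq (τ := τ) (hg.continuous.comp (by fun_prop)) ?_ fun z => ?_
    · exact (differentiable_expTwoPiI.comp (by fun_prop)).continuous.mul hg.continuous
    · have h := hf.add_coe z
      rw [hfg, hfg, ha.add_coe] at h
      have e : expTwoPiI (-m * (τ + 2 * z)) = expTwoPiI (-((m - 1 : ℤ) : ℂ) * (τ + 2 * z)) *
          expTwoPiI (-(1 : ℤ) * (τ + 2 * z)) := by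
        rw [← expTwoPiI_add]
        push_cast
        ring_nf
      rw [e] at h
      refine mul_left_cancel₀ (expTwoPiI_ne_zero (-(1 : ℤ) * (τ + 2 * z))) ?_
      linear_combination h

/-- A suitable power of `phiNegTwo` raises the index to 0; the product is then constant, and it
vanishes at 0. -/
lemma eq_zero_of_neg (hf : IsElliptic τ m f) (hm : m < 0) (z : ℂ) : f z = 0 := by
  obtain ⟨n, rfl⟩ := Int.eq_negSucc_of_lt_zero hm
  have h := hf.mul ((isElliptic_phiNegTwo τ).pow (n + 1))
  rw [show Int.negSucc n + ((n + 1 : ℕ) : ℤ) * 1 = 0 by simp [Int.negSucc_eq]] at h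
  have h2 (z : ℂ) : f z * phiNegTwo (τ, z) ^ (n + 1) = 0 := by
    rw [h.eq_const z 0, phiNegTwo_zero]
    simp
  refine eq_of_mul_eq_mul_of_countable (u := fun z => phiNegTwo (τ, z) ^ (n + 1))
    ((countable_phiNegTwo_zeros τ).mono fun z hz => eq_zero_of_pow_eq_zero hz)
    hf.differentiable.continuous continuous_const (fun z => ?_) z
  rw [mul_zero, mul_comm, h2]

end IsElliptic

/-! ### Modular transformation of the generators. -/

section transformation

variable (γ : SL(2, ℤ)) (τ : ℍ) (z : ℂ)

lemma coe_denom_ne_zero : (γ 1 0 : ℂ) * τ + γ 1 1 ≠ 0 := by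
  simpa [UpperHalfPlane.denom] using UpperHalfPlane.denom_ne_zero (γ : GL (Fin 2) ℝ) τ

/-- By division, an even function of index 1 vanishing at 0 is a constant multiple of `phiNegTwo`.
For the transform of `phiNegTwo` the z² coefficient gives the constant. For `phiZero`, the transform
minus the original vanishes at 0; since `phiZero` is z⁻² `phiNegTwo` up to order z³, the difference
is divisible by z³, whereas a nonzero multiple of `phiNegTwo` has order exactly 2. -/
lemma phi_slash :
    phiNegTwo (γ • τ, z / (γ 1 0 * τ + γ 1 1)) *
        expTwoPiI (-(1 : ℤ) * (γ 1 0 * z ^ 2 / (γ 1 0 * τ + γ 1 1))) =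
      ((γ 1 0 * τ + γ 1 1 : ℂ) ^ 2)⁻¹ * phiNegTwo (τ, z) ∧
    phiZero (γ • τ, z / (γ 1 0 * τ + γ 1 1)) *
        expTwoPiI (-(1 : ℤ) * (γ 1 0 * z ^ 2 / (γ 1 0 * τ + γ 1 1))) = phiZero (τ, z) := by
  have ha := (isElliptic_phiNegTwo (γ • τ)).slash
  have hb := (isElliptic_phiZero (γ • τ)).slash
  have hj := coe_denom_ne_zero γ τ
  set j := (γ 1 0 : ℂ) * τ + γ 1 1
  set u : ℂ → ℂ := fun z => expTwoPiI (-(1 : ℤ) * (γ 1 0 * z ^ 2 / j))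
  have hu : Differentiable ℂ u := differentiable_expTwoPiI.comp (by fun_prop)
  have hu0 : u 0 = 1 := by simp [u, expTwoPiI_zero]
  obtain ⟨h, k, hh, hk, hh0, hA, hB⟩ := exists_phiNegTwo_eq_phiZero_eq τ
  obtain ⟨h', k', hh', hk', hh0', hA', hB'⟩ := exists_phiNegTwo_eq_phiZero_eq (γ • τ)
  have hcomp {w : ℂ → ℂ} (hw : Differentiable ℂ w) : Differentiable ℂ fun z => w (z / j) :=
    hw.comp (f := fun z : ℂ => z / j) (by fun_prop)
  obtain ⟨C, hC, hCz⟩ := ha.exists_eq_phiNegTwo_mul (by simp [phiNegTwo_zero])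
  have hC0 (z : ℂ) : C z = C 0 := hC.eq_const z 0
  have e1 : ∀ z, (j ^ 2)⁻¹ * (h' (z / j) * u z) = C 0 * h z := by
    refine eq_of_pow_mul_eq_pow_mul 2 (((hcomp hh').mul hu).const_mul _).continuous
      (hh.const_mul _).continuous fun z => ?_
    have := hCz z
    rw [hA', hA, hC0, div_pow] at this
    simp only [u]
    linear_combination this
  have eC : C 0 = (j ^ 2)⁻¹ := by
    simpa [hh0, hh0', hu0] using (e1 0).symm
  obtain ⟨D, hD, hDz⟩ := (hb.sub (isElliptic_phiZero τ)).exists_eq_phiNegTwo_mul (by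
    simp [phiZero_zero, expTwoPiI_zero])
  have hD0 (z : ℂ) : D z = D 0 := hD.eq_const z 0
  -- The law for `phiNegTwo` divided by z²; it cancels the leading parts of the two `phiZero`
  -- expansions in `e3`.
  have e2 : ∀ z, h' (z / j) * u z = h z := fun z => by
    have := e1 z
    rw [eC] at this
    exact mul_left_cancel₀ (inv_ne_zero (pow_ne_zero 2 hj)) this
  have e3 : ∀ z, z * ((j ^ 3)⁻¹ * (k' (z / j) * u z) - k z) = D 0 * h z := by
    refine eq_of_pow_mul_eq_pow_mul 2 (differentiable_id.mul
      ((((hcomp hk').mul hu).const_mul _).sub hk)).continuous (hh.const_mul _).continuous fun z => ?_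
    have := hDz z
    rw [hB', hA, hB, hD0, div_pow] at this
    simp only [u] at e2 ⊢
    linear_combination this - e2 z
  have eD : D 0 = 0 := by simpa [hh0] using (e3 0).symm
  constructor
  · have := hCz z
    rw [hC0, eC] at this
    rw [this, mul_comm]
  · have := hDz z
    rw [hD0, eD, mul_zero] at this
    exact sub_eq_zero.mp this

lemma phiNegTwo_smul : phiNegTwo (γ • τ, z / (γ 1 0 * τ + γ 1 1)) =
    expTwoPiI (γ 1 0 * z ^ 2 / (γ 1 0 * τ + γ 1 1)) *
      (((γ 1 0 * τ + γ 1 1 : ℂ) ^ 2)⁻¹ * phiNegTwo (τ, z)) := by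
  rw [← (phi_slash γ τ z).1, mul_left_comm, ← expTwoPiI_add]
  simp [expTwoPiI_zero]

lemma phiZero_smul : phiZero (γ • τ, z / (γ 1 0 * τ + γ 1 1)) =
    expTwoPiI (γ 1 0 * z ^ 2 / (γ 1 0 * τ + γ 1 1)) * phiZero (τ, z) := by
  rw [← (phi_slash γ τ z).2, mul_left_comm, ← expTwoPiI_add]
  simp [expTwoPiI_zero]

end transformation

/-! ### Expansion in powers of the generators of index 1. -/

section decomposition

/-- Since `phiNegTwo` ^ i starts with z^(2i), the value f 0 is a Taylor coefficient of the product.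
This lets a Fourier expansion of the product alone control f 0. -/
lemma iteratedDeriv_phiNegTwo_pow_mul (τ : ℍ) (i : ℕ) {f : ℂ → ℂ} (hf : Differentiable ℂ f) :
    iteratedDeriv (2 * i) (fun z => phiNegTwo (τ, z) ^ i * f z) 0 = (2 * i).factorial * f 0 := by
  obtain ⟨h, k, hh, -, hh0, hA, -⟩ := exists_phiNegTwo_eq_phiZero_eq τ
  have : (fun z => phiNegTwo (τ, z) ^ i * f z) = fun z => z ^ (2 * i) * (h z ^ i * f z) := by
    ext z
    rw [hA]
    ring
  rw [this, iteratedDeriv_pow_mul_zero _ (by fun_prop), hh0]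
  simp

/-- A family of elliptic functions of index `d` with a Fourier expansion (after multiplication by a
power of `phiNegTwo`) is a homogeneous polynomial in the generators of index `1`, with coefficients
which are holomorphic in `q`. -/
lemma exists_decomposition (d : ℕ) : ∀ (i : ℕ) (φ : ℍ × ℂ → ℂ) (ψ : ℍ → ℂ → ℂ), HasFourier φ →
    (∀ τ, IsElliptic τ d (ψ τ)) → (∀ τ z, φ (τ, z) = phiNegTwo (τ, z) ^ i * ψ τ z) →
    ∃ f : ℕ → ℍ → ℂ, (∀ j, HasQExpansion (f j)) ∧ ∀ τ z, ψ τ z =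
      ∑ j ∈ Finset.range (d + 1), f j τ * (phiNegTwo (τ, z) ^ j * phiZero (τ, z) ^ (d - j)) := by
  have hq {i : ℕ} {φ : ℍ × ℂ → ℂ} {ψ : ℍ → ℂ → ℂ} (hφ : HasFourier φ)
      (hψ : ∀ τ, Differentiable ℂ (ψ τ)) (h : ∀ τ z, φ (τ, z) = phiNegTwo (τ, z) ^ i * ψ τ z) :
      HasQExpansion fun τ => ψ τ 0 := by
    have := (HasQExpansion.const ((2 * i).factorial : ℂ)⁻¹).mul (hφ.iteratedDeriv_zero (2 * i))
    convert! this using 2 with τ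
    have hf : ((2 * i).factorial : ℂ) ≠ 0 := by exact_mod_cast Nat.factorial_ne_zero _
    rw [funext (h τ), iteratedDeriv_phiNegTwo_pow_mul τ i (hψ τ), inv_mul_cancel_left₀ hf]
  induction d with
  | zero =>
    intro i φ ψ hφ hψ h
    refine ⟨fun _ τ => ψ τ 0, fun _ => hq hφ (fun τ => (hψ τ).differentiable) h, fun τ z => ?_⟩
    have : IsElliptic τ 0 (ψ τ) := by simpa using hψ τ
    simp [this.eq_const z 0]
  | succ d ih =>
    intro i φ ψ hφ hψ h
    have h0 := hq hφ (fun τ => (hψ τ).differentiable) h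
    have hg (τ : ℍ) : ∃ g, IsElliptic τ d g ∧
        ∀ z, ψ τ z - ψ τ 0 * phiZero (τ, z) ^ (d + 1) = phiNegTwo (τ, z) * g z := by
      have hb := ((isElliptic_phiZero τ).pow (d + 1)).const_mul (ψ τ 0)
      rw [mul_one] at hb
      have := ((hψ τ).sub hb).exists_eq_phiNegTwo_mul (by simp [phiZero_zero])
      simpa using this
    choose g hg hψg using hg
    -- No Fourier expansion is known for the quotient g itself, but there is one for `phiNegTwo` ^
    -- (i + 1) * g; hence the exponent i in the statement.
    obtain ⟨f, hf, hgf⟩ := ih (i + 1)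
      (fun p => φ p - ψ p.1 0 * (phiNegTwo p ^ i * phiZero p ^ (d + 1))) g
      (hφ.sub ((HasFourier.of_hasQExpansion h0).mul
        ((hasFourier_phiNegTwo.pow i).mul (hasFourier_phiZero.pow (d + 1))))) hg
      fun τ z => by
        rw [h]
        linear_combination phiNegTwo (τ, z) ^ i * hψg τ z
    refine ⟨fun j => j.casesOn (fun τ => ψ τ 0) f, fun j => ?_, fun τ z => ?_⟩
    · cases j with
      | zero => exact h0
      | succ j => exact hf j
    · rw [Finset.sum_range_succ', ← sub_eq_iff_eq_add]
      simp only [pow_zero, one_mul, Nat.sub_zero, Nat.add_sub_add_right]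
      refine (hψg τ z).trans ?_
      rw [hgf, Finset.mul_sum]
      exact Finset.sum_congr rfl fun j _ => by ring

/-- At z = 0 only the term j = 0 survives; the rest can be divided by `phiNegTwo`. -/
lemma decomposition_unique (τ : ℍ) (d : ℕ) : ∀ c : ℕ → ℂ,
    (∀ z, ∑ j ∈ Finset.range (d + 1),
      c j * (phiNegTwo (τ, z) ^ j * phiZero (τ, z) ^ (d - j)) = 0) → ∀ j ≤ d, c j = 0 := by
  have key (d : ℕ) (c : ℕ → ℂ) (h : ∀ z, ∑ j ∈ Finset.range (d + 1),
      c j * (phiNegTwo (τ, z) ^ j * phiZero (τ, z) ^ (d - j)) = 0) : c 0 = 0 := by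
    have h0 := h 0
    rw [Finset.sum_range_succ'] at h0
    simpa [phiNegTwo_zero, phiZero_zero] using h0
  induction d with
  | zero =>
    intro c h j hj
    rw [Nat.le_zero.mp hj]
    exact key 0 c h
  | succ d ih =>
    intro c h j hj
    cases j with
    | zero => exact key _ c h
    | succ j =>
      refine ih (fun j => c (j + 1)) (fun z => ?_) j (by omega)
      have ha := (isElliptic_phiNegTwo τ).differentiable.continuous
      have hb := (isElliptic_phiZero τ).differentiable.continuous
      refine IsElliptic.eq_of_phiNegTwo_mul_eq (τ := τ) (p := fun z => ∑ j ∈ Finset.range (d + 1),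
        c (j + 1) * (phiNegTwo (τ, z) ^ j * phiZero (τ, z) ^ (d - j))) (q := fun _ => 0)
        (by fun_prop) continuous_const (fun z => ?_) z
      have hz := h z
      rw [Finset.sum_range_succ', key _ c h] at hz
      rw [mul_zero, ← hz, Finset.mul_sum]
      simp only [zero_mul, add_zero, Nat.add_sub_add_right]
      exact Finset.sum_congr rfl fun j _ => by ring

end decomposition

namespace IsWeakJacobiForm

variable {m : ℤ} {φ : ℍ × ℂ → ℂ}

lemma isElliptic (hφ : IsWeakJacobiForm 0 m φ) (τ : ℍ) : IsElliptic τ m fun z => φ (τ, z) := by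
  refine ⟨HasFourier.differentiable hφ.fourier τ, fun z => ?_, fun z => ?_, fun z => ?_⟩
  · have h := hφ.modular (-1) τ z
    have hs : (-1 : SL(2, ℤ)) • τ = τ := by
      rw [ModularGroup.SL_neg_smul, one_smul]
    rw [hs] at h
    simpa [expTwoPiI_zero, div_neg] using h
  · simpa [expTwoPiI_zero] using hφ.elliptic 0 1 τ z
  · simpa using hφ.elliptic 1 0 τ z

lemma eq_zero_of_neg (hφ : IsWeakJacobiForm 0 m φ) (hm : m < 0) : φ = 0 :=
  funext fun p => (hφ.isElliptic p.1).eq_zero_of_neg hm p.2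

/-- Weak Jacobi forms of weight zero are polynomials in the generators of index `1`, with
holomorphic coefficients which transform like modular forms. -/
lemma exists_decomposition {d : ℕ} (hφ : IsWeakJacobiForm 0 d φ) :
    ∃ f : ℕ → ℍ → ℂ, (∀ j, HasQExpansion (f j)) ∧
      (∀ j ≤ d, ∀ (γ : SL(2, ℤ)) (τ : ℍ), f j (γ • τ) = (γ 1 0 * τ + γ 1 1 : ℂ) ^ (2 * j) * f j τ) ∧
      ∀ τ z, φ (τ, z) =
        ∑ j ∈ Finset.range (d + 1), f j τ * (phiNegTwo (τ, z) ^ j * phiZero (τ, z) ^ (d - j)) := by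
  obtain ⟨f, hf, hφf⟩ := _root_.exists_decomposition d 0 φ (fun τ z => φ (τ, z)) hφ.fourier
    hφ.isElliptic fun τ z => by simp
  refine ⟨f, hf, fun j hj γ τ => ?_, hφf⟩
  have hj0 := coe_denom_ne_zero γ τ
  -- The decompositions at γτ and at τ are compared coefficient by coefficient, after removing the
  -- common factor e(...)^d.
  have h := decomposition_unique τ d
    (fun j => f j (γ • τ) * (((γ 1 0 * τ + γ 1 1 : ℂ) ^ 2)⁻¹) ^ j - f j τ) (fun z => ?_) j hj
  · rw [sub_eq_zero, inv_pow, ← pow_mul] at h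
    rw [← h]
    field_simp
  · have hm := hφ.modular γ τ z
    rw [zpow_zero, one_mul, hφf, hφf τ] at hm
    simp only [phiNegTwo_smul, phiZero_smul, Int.cast_natCast] at hm
    rw [expTwoPiI_nat_mul] at hm
    refine mul_left_cancel₀ (pow_ne_zero d (expTwoPiI_ne_zero
      ((γ 1 0 : ℂ) * z ^ 2 / (γ 1 0 * τ + γ 1 1)))) ?_
    rw [mul_zero]
    refine Eq.trans ?_ (sub_eq_zero.mpr hm)
    rw [Finset.mul_sum, Finset.mul_sum, ← Finset.sum_sub_distrib]
    refine Finset.sum_congr rfl fun i hi => ?_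
    have hid : i + (d - i) = d := by
      have := Finset.mem_range.mp hi
      omega
    generalize expTwoPiI ((γ 1 0 : ℂ) * z ^ 2 / (γ 1 0 * τ + γ 1 1)) = e
    rw [mul_pow, mul_pow, mul_pow, show e ^ d = e ^ i * e ^ (d - i) by rw [← pow_add, hid]]
    ring

end IsWeakJacobiForm

/-! ### Modular forms of level one as polynomials in E₄ and E₆. -/

open EisensteinSeries ModularForm

lemma hasQExpansion_modularForm {k : ℤ} (f : ModularForm 𝒮ℒ k) : HasQExpansion f := by
  refine ⟨UpperHalfPlane.cuspFunction 1 f, fun q hq =>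
    (ModularFormClass.differentiableAt_cuspFunction f one_pos one_mem_strictPeriods_SL
      (mem_ball_zero_iff.mp hq)).differentiableWithinAt, fun τ => ?_⟩
  have := SlashInvariantFormClass.eq_cuspFunction f τ one_mem_strictPeriods_SL one_ne_zero
  rw [← this]
  simp [Function.Periodic.qParam, expTwoPiI]

lemma modularForm_smul {k : ℤ} (f : ModularForm 𝒮ℒ k) (γ : SL(2, ℤ)) (τ : ℍ) :
    f (γ • τ) = (γ 1 0 * τ + γ 1 1 : ℂ) ^ k * f τ := by
  have hγ : (γ : GL (Fin 2) ℝ) ∈ 𝒮ℒ := ⟨γ, rfl⟩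
  have := SlashInvariantForm.slash_action_eqn' f hγ τ
  simpa using! this

/-- Invariance under SL(2, ℤ) reduces boundedness at every cusp to the cusp ∞, where it is
continuity of the `q`-expansion at q = 0. -/
lemma exists_modularForm {k : ℤ} {f : ℍ → ℂ} (hf : HasQExpansion f)
    (h : ∀ (γ : SL(2, ℤ)) (τ : ℍ), f (γ • τ) = (γ 1 0 * τ + γ 1 1 : ℂ) ^ k * f τ) :
    ∃ g : ModularForm 𝒮ℒ k, (g : ℍ → ℂ) = f := by
  have hs (γ : SL(2, ℤ)) : f ∣[k] γ = f := by
    ext τ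
    rw [ModularForm.SL_slash_apply, h, mul_right_comm]
    have : (UpperHalfPlane.denom γ τ : ℂ) = γ 1 0 * τ + γ 1 1 := by simp [UpperHalfPlane.denom]
    rw [this, ← zpow_add₀ (coe_denom_ne_zero γ τ)]
    simp
  refine ⟨{ toFun := f
            slash_action_eq' := fun _ ⟨γ, hγ⟩ => hγ ▸ hs γ
            holo' := hf.mdifferentiable
            bdd_at_cusps' := fun {c} hc => ?_ }, rfl⟩
  rw [Subgroup.IsArithmetic.isCusp_iff_isCusp_SL2Z] at hc
  rw [OnePoint.isBoundedAt_iff_forall_SL2Z hc]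
  intro γ _
  rw [hs]
  exact hf.isBoundedAtImInfty

/-- The span of the monomials of weight `2i` in the Eisenstein series of weights `4` and `6`. -/
def eisensteinSpan (i : ℕ) : Submodule ℂ (ℍ → ℂ) :=
  Submodule.span ℂ {f | ∃ x y : ℕ, 2 * x + 3 * y = i ∧ f = fun τ => E₄ τ ^ x * E₆ τ ^ y}

lemma discriminant_mul_mem_eisensteinSpan {i : ℕ} {f : ℍ → ℂ} (hf : f ∈ eisensteinSpan i) :
    (fun τ => ModularForm.discriminant τ * f τ) ∈ eisensteinSpan (i + 6) := by
  induction hf using Submodule.span_induction with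
  | mem f hf =>
    obtain ⟨x, y, rfl, rfl⟩ := hf
    have h1 : (fun τ => E₄ τ ^ (x + 3) * E₆ τ ^ y) ∈ eisensteinSpan (2 * x + 3 * y + 6) :=
      Submodule.subset_span ⟨x + 3, y, by ring, rfl⟩
    have h2 : (fun τ => E₄ τ ^ x * E₆ τ ^ (y + 2)) ∈ eisensteinSpan (2 * x + 3 * y + 6) :=
      Submodule.subset_span ⟨x, y + 2, by ring, rfl⟩
    convert! Submodule.smul_mem _ (1 / 1728 : ℂ) (Submodule.sub_mem _ h1 h2) using 1
    ext τ
    simp only [discriminant_eq_E₄_cube_sub_E₆_sq, Pi.smul_apply, Pi.sub_apply, smul_eq_mul]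
    ring
  | zero =>
    simp only [Pi.zero_apply, mul_zero]
    exact Submodule.zero_mem _
  | add f g _ _ hf hg => simpa [mul_add] using! Submodule.add_mem _ hf hg
  | smul t f _ hf => simpa [mul_left_comm] using! Submodule.smul_mem _ t hf

/-- Subtracting a multiple of a monomial with constant term 1 leaves a cusp form, which is the
discriminant times a form of weight lower by 12. -/
lemma modularForm_mem_eisensteinSpan (i : ℕ) : ∀ (k : ℤ), k = 2 * i →
    ∀ f : ModularForm 𝒮ℒ k, (f : ℍ → ℂ) ∈ eisensteinSpan i := by
  induction i using Nat.strong_induction_on with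
  | _ i ih =>
  intro k hk f
  -- Weight 2 is the only case with no monomial: 2x + 3y = 1 has no solution.
  rcases eq_or_ne i 1 with rfl | hi
  · obtain rfl : k = 2 := by simpa using hk
    have : f = 0 := rank_zero_iff_forall_zero.mp levelOne_weight_two_rank_zero f
    rw [this, FunLike.coe_zero]
    exact Submodule.zero_mem _
  obtain ⟨x, y, hxy⟩ : ∃ x y : ℕ, 2 * x + 3 * y = i := by
    rcases Nat.even_or_odd' i with ⟨c, rfl | rfl⟩
    · exact ⟨c, 0, by ring⟩
    · exact ⟨c - 1, 1, by omega⟩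
  let g : ModularForm 𝒮ℒ k := ModularForm.mcast (by rw [hk, ← hxy]; push_cast; ring)
    ((E₄.pow x).mul (E₆.pow y))
  have hg : (g : ℍ → ℂ) = fun τ => E₄ τ ^ x * E₆ τ ^ y := by
    ext τ
    simp [g, ModularForm.coe_mcast, ModularForm.coe_pow, ModularForm.coe_mul]
  have hg0 : (UpperHalfPlane.qExpansion 1 g).coeff 0 = 1 := by
    have : (g : ℍ → ℂ) = (E₄.pow x).mul (E₆.pow y) := by simp [g]
    rw [this, ModularForm.qExpansion_mul one_pos one_mem_strictPeriods_SL,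
      ModularForm.qExpansion_pow one_pos one_mem_strictPeriods_SL,
      ModularForm.qExpansion_pow one_pos one_mem_strictPeriods_SL]
    have h4 := E_qExpansion_coeff_zero (k := 4) (by norm_num) ⟨2, rfl⟩
    have h6 := E_qExpansion_coeff_zero (k := 6) (by norm_num) ⟨3, rfl⟩
    rw [PowerSeries.coeff_zero_eq_constantCoeff] at h4 h6 ⊢
    rw [map_mul, map_pow, map_pow, h4, h6]
    simp
  obtain ⟨h, hh⟩ := ModularForm.sub_smul_isCuspForm f g hg0
  set c := (UpperHalfPlane.qExpansion 1 f).coeff 0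
  have hf : (f : ℍ → ℂ) = c • (g : ℍ → ℂ) +
      fun τ => ModularForm.discriminant τ * CuspForm.discriminantEquiv h τ := by
    ext τ
    have := DFunLike.congr_fun hh τ
    simp only [CuspForm.toModularFormₗ_apply, FunLike.coe_sub, FunLike.coe_smul, Pi.sub_apply] at this
    simp only [discriminant_mul_discriminantEquiv_apply, this, Pi.add_apply]
    ring
  rw [hf]
  refine Submodule.add_mem _ (Submodule.smul_mem _ c ?_) ?_
  · rw [hg]
    exact Submodule.subset_span ⟨x, y, hxy, rfl⟩
  · rcases lt_or_ge i 6 with h6 | h6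
    · have : (CuspForm.discriminantEquiv h : ℍ → ℂ) = 0 :=
        ModularFormClass.levelOne_neg_weight_eq_zero (k := k - 12) (by omega) _
      simp only [this, Pi.zero_apply, mul_zero]
      exact Submodule.zero_mem _
    · obtain ⟨j, rfl⟩ := Nat.exists_eq_add_of_le' h6
      exact discriminant_mul_mem_eisensteinSpan (ih j (by omega) (k - 12)
        (by rw [hk]; push_cast; ring) _)

/-! ### Ratios taking infinitely many values. -/

/-- A finite set of nonzero values would stay away from the limit 0. -/
lemma infinite_image_of_tendsto {α : Type*} {l : Filter α} [l.NeBot] {f : α → ℂ} {s : Set α}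
    (h : Filter.Tendsto f l (nhds 0)) (h0 : ∀ᶠ x in l, f x ≠ 0) (hs : ∀ᶠ x in l, x ∈ s) :
    (f '' s).Infinite := by
  intro hfin
  have hopen : ((f '' s) \ {0})ᶜ ∈ nhds (0 : ℂ) :=
    (hfin.subset Set.sdiff_subset).isClosed.isOpen_compl.mem_nhds (by simp)
  obtain ⟨x, h1, h2, h3⟩ := ((h.eventually hopen).and (h0.and hs)).exists
  exact h1 ⟨⟨x, h3, rfl⟩, h2⟩

lemma infinite_phiNegTwo_div_phiZero (τ : ℍ) :
    ((fun z => phiNegTwo (τ, z) / phiZero (τ, z)) ''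
      {z | phiNegTwo (τ, z) ≠ 0 ∧ phiZero (τ, z) ≠ 0}).Infinite := by
  have ha := (isElliptic_phiNegTwo τ).differentiable.continuous
  have hb := (isElliptic_phiZero τ).differentiable.continuous
  have hb0 : ∀ᶠ z in nhdsWithin (0 : ℂ) {0}ᶜ, phiZero (τ, z) ≠ 0 :=
    (hb.continuousAt.eventually_ne (by simp [phiZero_zero])).filter_mono nhdsWithin_le_nhds
  have ha0 : ∀ᶠ z in nhdsWithin (0 : ℂ) {0}ᶜ, phiNegTwo (τ, z) ≠ 0 := by
    obtain ⟨h, k, hh, -, hh0, hA, -⟩ := exists_phiNegTwo_eq_phiZero_eq τ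
    filter_upwards [(hh.continuous.continuousAt.eventually_ne
      (show h 0 ≠ 0 by simp [hh0])).filter_mono nhdsWithin_le_nhds, self_mem_nhdsWithin] with z hz hz0
    rw [hA]
    exact mul_ne_zero (pow_ne_zero 2 hz0) hz
  refine infinite_image_of_tendsto (l := nhdsWithin (0 : ℂ) {0}ᶜ) ?_ ?_ ?_
  · have : ContinuousAt (fun z => phiNegTwo (τ, z) / phiZero (τ, z)) 0 :=
      ha.continuousAt.div hb.continuousAt (by simp [phiZero_zero])
    simpa [ContinuousAt, phiNegTwo_zero] using this.tendsto.mono_left nhdsWithin_le_nhds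
  · filter_upwards [ha0, hb0] with z h1 h2
    exact div_ne_zero h1 h2
  · filter_upwards [ha0, hb0] with z h1 h2
    exact ⟨h1, h2⟩

/-- The ratio minus 1 tends to 0 at the cusp, and it is nonzero wherever E₆ is, because the
discriminant has no zeros. -/
lemma infinite_eisenstein_ratio :
    ((fun τ : ℍ => E₄ τ ^ 3 / E₆ τ ^ 2) '' {τ | E₄ τ ≠ 0 ∧ E₆ τ ≠ 0}).Infinite := by
  have hlim {k : ℕ} (hk : 3 ≤ k) (hk2 : Even k) :
      Filter.Tendsto (E hk) UpperHalfPlane.atImInfty (nhds 1) := by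
    obtain ⟨F, hF, hEF⟩ := hasQExpansion_modularForm (E hk)
    have hc : ContinuousAt F 0 :=
      (hF.differentiableAt (Metric.ball_mem_nhds _ one_pos)).continuousAt
    have ht := hc.tendsto.comp (UpperHalfPlane.qParam_tendsto_atImInfty one_pos)
    have hE : (E hk : ℍ → ℂ) = F ∘ fun τ : ℍ => Function.Periodic.qParam 1 τ := by
      ext τ
      simp [hEF, Function.Periodic.qParam, expTwoPiI]
    rw [← hE] at ht
    have h0 := UpperHalfPlane.qExpansion_coeff_zero one_pos
      (ModularFormClass.analyticAt_cuspFunction_zero (E hk) one_pos one_mem_strictPeriods_SL)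
      (SlashInvariantFormClass.periodic_comp_ofComplex (E hk) one_mem_strictPeriods_SL)
    rw [E_qExpansion_coeff_zero hk hk2, UpperHalfPlane.valueAtInfty, ht.limUnder_eq] at h0
    rwa [← h0] at ht
  have h4 := hlim (k := 4) (by norm_num) ⟨2, rfl⟩
  have h6 := hlim (k := 6) (by norm_num) ⟨3, rfl⟩
  have e4 := h4.eventually_ne one_ne_zero
  have e6 := h6.eventually_ne one_ne_zero
  have h := infinite_image_of_tendsto (l := UpperHalfPlane.atImInfty)
    (f := fun τ : ℍ => E₄ τ ^ 3 / E₆ τ ^ 2 - 1) (s := {τ | E₄ τ ≠ 0 ∧ E₆ τ ≠ 0}) ?_ ?_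
    (by filter_upwards [e4, e6] with τ h1 h2 using ⟨h1, h2⟩)
  · refine fun hfin => h ?_
    rw [show (fun τ : ℍ => E₄ τ ^ 3 / E₆ τ ^ 2 - 1) =
      (fun w : ℂ => w - 1) ∘ fun τ : ℍ => E₄ τ ^ 3 / E₆ τ ^ 2 from rfl, Set.image_comp]
    exact hfin.image _
  · simpa using ((h4.pow 3).div (h6.pow 2) (by simp)).sub_const 1
  · filter_upwards [e6] with τ h1 h2
    have hΔ := discriminant_eq_E₄_cube_sub_E₆_sq τ
    rw [sub_eq_zero, div_eq_one_iff_eq (pow_ne_zero 2 h1)] at h2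
    rw [h2, sub_self, zero_div] at hΔ
    exact discriminant_ne_zero τ hΔ

/-! ### The three generators as weak Jacobi forms. -/

namespace IsWeakJacobiForm

lemma phiNegTwo : IsWeakJacobiForm (-2) 1 phiNegTwo where
  holomorphic := hasFourier_phiNegTwo.differentiableOn
  modular γ τ z := by
    rw [phiNegTwo_smul, Int.cast_one, one_mul, zpow_neg]
    norm_cast
    ring
  elliptic a b τ z := (isElliptic_phiNegTwo τ).add_lattice z a b
  fourier := hasFourier_phiNegTwo

lemma phiZero : IsWeakJacobiForm 0 1 phiZero where
  holomorphic := hasFourier_phiZero.differentiableOn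
  modular γ τ z := by
    rw [phiZero_smul, Int.cast_one, one_mul, zpow_zero, one_mul]
  elliptic a b τ z := (isElliptic_phiZero τ).add_lattice z a b
  fourier := hasFourier_phiZero

lemma of_modularForm {k : ℤ} (f : ModularForm 𝒮ℒ k) :
    IsWeakJacobiForm k 0 fun p => f p.1 where
  holomorphic := (HasFourier.of_hasQExpansion (hasQExpansion_modularForm f)).differentiableOn
  modular γ τ z := by
    rw [modularForm_smul]
    simp [expTwoPiI_zero]
  elliptic a b τ z := by simp [expTwoPiI_zero]
  fourier := HasFourier.of_hasQExpansion (hasQExpansion_modularForm f)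

lemma E₄_mul_phiNegTwo_sq :
    IsWeakJacobiForm 0 2 fun p => E₄ p.1 * _root_.phiNegTwo p ^ 2 := by
  convert! (of_modularForm E₄).mul (phiNegTwo.mul phiNegTwo) using 1
  ext p
  simp [sq]

lemma E₆_mul_phiNegTwo_cube :
    IsWeakJacobiForm 0 3 fun p => E₆ p.1 * _root_.phiNegTwo p ^ 3 := by
  convert! (of_modularForm E₆).mul (phiNegTwo.mul (phiNegTwo.mul phiNegTwo)) using 1
  ext p
  simp [pow_succ, mul_assoc]

end IsWeakJacobiForm

/-! ### Generation of the graded ring. -/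

/-- The functions which, regarded as elements of degree `m` of the ring of weak Jacobi forms of
weight zero, belong to a given subalgebra. -/
def degreePart (S : Subalgebra ℂ WeakJacobiRing) (m : ℤ) : Submodule ℂ (ℍ × ℂ → ℂ) :=
  (S.toSubmodule.comap (DirectSum.lof ℂ ℤ (fun m : ℤ => weakJacobiForm 0 m) m)).map
    (weakJacobiForm 0 m).subtype

section

variable {S : Subalgebra ℂ WeakJacobiRing} {m n : ℤ}

lemma coe_mem_degreePart {φ : weakJacobiForm 0 m} :
    (φ : ℍ × ℂ → ℂ) ∈ degreePart S m ↔ WeakJacobiRing.of m φ ∈ S := by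
  refine ⟨fun ⟨ψ, hψ, h⟩ => ?_, fun h => ⟨φ, h, rfl⟩⟩
  obtain rfl : ψ = φ := Subtype.ext h
  exact hψ

lemma mul_mem_degreePart {F G : ℍ × ℂ → ℂ} (hF : F ∈ degreePart S m) (hG : G ∈ degreePart S n) :
    F * G ∈ degreePart S (m + n) := by
  obtain ⟨φ, hφ, rfl⟩ := hF
  obtain ⟨ψ, hψ, rfl⟩ := hG
  refine ⟨⟨φ.1 * ψ.1, IsWeakJacobiForm.mul φ.2 ψ.2⟩, ?_, rfl⟩
  have := S.mul_mem hφ hψ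
  rwa [DirectSum.lof_eq_of, DirectSum.lof_eq_of, DirectSum.of_mul_of] at this

lemma pow_mem_degreePart {F : ℍ × ℂ → ℂ} (hF : F ∈ degreePart S m) (k : ℕ) :
    F ^ k ∈ degreePart S (k * m) := by
  induction k with
  | zero =>
    rw [Nat.cast_zero, zero_mul]
    exact ⟨⟨1, .one⟩, S.one_mem, (pow_zero F).symm⟩
  | succ k ih =>
    rw [pow_succ, Nat.cast_succ, add_mul, one_mul]
    exact mul_mem_degreePart ih hF

/-- For j = 2x + 3y the power `phiNegTwo` ^ j splits into x squares, absorbed by E₄, and y cubes,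
absorbed by E₆. -/
lemma eisensteinSpan_mul_mem_degreePart (h1 : phiZero ∈ degreePart S 1)
    (h2 : (fun p => E₄ p.1 * phiNegTwo p ^ 2) ∈ degreePart S 2)
    (h3 : (fun p => E₆ p.1 * phiNegTwo p ^ 3) ∈ degreePart S 3)
    {j d : ℕ} (hj : j ≤ d) {f : ℍ → ℂ} (hf : f ∈ eisensteinSpan j) :
    (fun p => f p.1 * (phiNegTwo p ^ j * phiZero p ^ (d - j))) ∈ degreePart S d := by
  induction hf using Submodule.span_induction with
  | mem f hf =>
    obtain ⟨x, y, rfl, rfl⟩ := hf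
    have h := mul_mem_degreePart (mul_mem_degreePart (pow_mem_degreePart h2 x)
      (pow_mem_degreePart h3 y)) (pow_mem_degreePart h1 (d - (2 * x + 3 * y)))
    have hd : (x * 2 + y * 3 + (d - (2 * x + 3 * y) : ℕ) * 1 : ℤ) = d := by
      push_cast [hj]
      ring
    rw [hd] at h
    convert! h using 1
    ext p
    simp only [Pi.mul_apply, Pi.pow_apply]
    ring
  | zero =>
    simp only [Pi.zero_apply, zero_mul]
    exact Submodule.zero_mem _
  | add f g _ _ hf hg => simpa [add_mul] using! Submodule.add_mem _ hf hg
  | smul t f _ hf => simpa [mul_assoc] using! Submodule.smul_mem _ t hf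

lemma eq_top_of_mem_degreePart (h1 : phiZero ∈ degreePart S 1)
    (h2 : (fun p => E₄ p.1 * phiNegTwo p ^ 2) ∈ degreePart S 2)
    (h3 : (fun p => E₆ p.1 * phiNegTwo p ^ 3) ∈ degreePart S 3) : S = ⊤ := by
  refine Algebra.eq_top_iff.mpr fun x => ?_
  induction x using DirectSum.induction_on with
  | zero => exact S.zero_mem
  | add x y hx hy => exact S.add_mem hx hy
  | of m φ =>
    refine coe_mem_degreePart.mp ?_
    rcases lt_or_ge m 0 with hm | hm
    · rw [IsWeakJacobiForm.eq_zero_of_neg φ.2 hm]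
      exact Submodule.zero_mem _
    · obtain ⟨d, rfl⟩ := Int.eq_ofNat_of_zero_le hm
      obtain ⟨f, hq, hf, h⟩ := IsWeakJacobiForm.exists_decomposition φ.2
      have hφ : (φ : ℍ × ℂ → ℂ) = ∑ j ∈ Finset.range (d + 1),
          fun p => f j p.1 * (phiNegTwo p ^ j * phiZero p ^ (d - j)) := by
        ext p
        rw [Finset.sum_apply]
        exact h p.1 p.2
      rw [hφ]
      refine Submodule.sum_mem _ fun j hj => ?_
      have hj' : j ≤ d := Nat.lt_succ_iff.mp (Finset.mem_range.mp hj)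
      refine eisensteinSpan_mul_mem_degreePart h1 h2 h3 hj' ?_
      obtain ⟨g, hg⟩ := exists_modularForm (k := 2 * j) (hq j)
        fun γ τ => by rw [hf j hj' γ τ]; norm_cast
      rw [← hg]
      exact modularForm_mem_eisensteinSpan j _ rfl g

end

/-! ### Algebraic independence. -/

/-- Evaluation at a point of `ℍ × ℂ`, weighted by the powers of a unit `t` according to the
degree. -/
def evalAlgHom (p : ℍ × ℂ) (t : ℂˣ) : WeakJacobiRing →ₐ[ℂ] ℂ :=
  DirectSum.toAlgebra ℂ (fun m : ℤ => weakJacobiForm 0 m)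
    (fun m => ((t ^ m : ℂˣ) : ℂ) • (LinearMap.proj p ∘ₗ (weakJacobiForm 0 m).subtype))
    (by
      change ((t ^ (0 : ℤ) : ℂˣ) : ℂ) * (1 : ℂ) = 1
      simp)
    (fun {i j} φ ψ => by
      change ((t ^ (i + j) : ℂˣ) : ℂ) * (φ.1 p * ψ.1 p) =
        ((t ^ i : ℂˣ) : ℂ) * φ.1 p * (((t ^ j : ℂˣ) : ℂ) * ψ.1 p)
      rw [zpow_add]
      push_cast
      ring)

lemma evalAlgHom_of (p : ℍ × ℂ) (t : ℂˣ) (m : ℤ) (φ : weakJacobiForm 0 m) :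
    evalAlgHom p t (WeakJacobiRing.of m φ) = (t : ℂ) ^ m * φ.1 p := by
  refine (DirectSum.toAddMonoid_of (fun m : ℤ => (((t ^ m : ℂˣ) : ℂ) •
    (LinearMap.proj p ∘ₗ (weakJacobiForm 0 m).subtype)).toAddMonoidHom) m φ).trans ?_
  simp

lemma MvPolynomial.eval_update_eq_zero_of_infinite {σ K : Type*} [DecidableEq σ] [Field K]
    (P : MvPolynomial σ K) (x : σ → K) (i : σ)
    (h : {w | MvPolynomial.eval (Function.update x i w) P = 0}.Infinite) (w : K) :
    MvPolynomial.eval (Function.update x i w) P = 0 := by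
  let p : Polynomial K :=
    MvPolynomial.aeval (Function.update (fun j => Polynomial.C (x j)) i Polynomial.X) P
  have hp (w : K) : p.eval w = MvPolynomial.eval (Function.update x i w) P := by
    rw [← Polynomial.coe_evalRingHom, ← Polynomial.coe_aeval_eq_evalRingHom]
    change Polynomial.aeval w (MvPolynomial.aeval _ P) = _
    have hx : (fun j => Polynomial.aeval w
        (Function.update (fun j => Polynomial.C (x j)) i Polynomial.X j)) =
        Function.update x i w := by
      ext j
      rcases eq_or_ne j i with rfl | hj
      · simp
      · simp [hj]
    rw [← AlgHom.comp_apply, MvPolynomial.comp_aeval, hx, MvPolynomial.aeval_eq_eval]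
  have h0 : p = 0 := p.eq_zero_of_infinite_isRoot (h.mono fun w hw => (hp w).trans hw)
  rw [← hp, h0, Polynomial.eval_zero]

lemma update_vec_zero {α : Type*} (a b c w : α) : Function.update ![a, b, c] 0 w = ![w, b, c] := by
  ext j
  fin_cases j <;> rfl

lemma update_vec_one {α : Type*} (a b c w : α) : Function.update ![a, b, c] 1 w = ![a, w, c] := by
  ext j
  fin_cases j <;> rfl

lemma update_vec_two {α : Type*} (a b c w : α) : Function.update ![a, b, c] 2 w = ![a, b, w] := by
  ext j
  fin_cases j <;> rfl

lemma mvPolynomial_eq_zero_of_eval_phi {P : MvPolynomial (Fin 3) ℂ}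
    (h : ∀ (τ : ℍ) (z : ℂ) (t : ℂˣ), MvPolynomial.eval ![t * phiZero (τ, z),
      t ^ 2 * (E₄ τ * phiNegTwo (τ, z) ^ 2), t ^ 3 * (E₆ τ * phiNegTwo (τ, z) ^ 3)] P = 0) :
    P = 0 := by
  have step1 (τ : ℍ) (v : ℂ) (hv : v ≠ 0) (u : ℂ) :
      MvPolynomial.eval ![u, E₄ τ * v ^ 2, E₆ τ * v ^ 3] P = 0 := by
    have key := P.eval_update_eq_zero_of_infinite ![0, E₄ τ * v ^ 2, E₆ τ * v ^ 3] 0 ?_ u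
    · rwa [update_vec_zero] at key
    refine ((infinite_phiNegTwo_div_phiZero τ).image (f := fun w => v * w⁻¹)
      fun _ _ _ _ h => inv_injective (mul_left_cancel₀ hv h)).mono ?_
    rintro _ ⟨_, ⟨z, ⟨ha, hb⟩, rfl⟩, rfl⟩
    -- The scaling t = v / `phiNegTwo` freezes the last two coordinates, while the first runs
    -- through v times the infinitely many values of `phiZero` / `phiNegTwo`.
    have hz := h τ z (Units.mk0 (v / phiNegTwo (τ, z)) (div_ne_zero hv ha))
    have e1 : v / phiNegTwo (τ, z) * phiZero (τ, z) =
        v * (phiNegTwo (τ, z) / phiZero (τ, z))⁻¹ := by field_simp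
    have e2 : (v / phiNegTwo (τ, z)) ^ 2 * (E₄ τ * phiNegTwo (τ, z) ^ 2) = E₄ τ * v ^ 2 := by
      field_simp
    have e3 : (v / phiNegTwo (τ, z)) ^ 3 * (E₆ τ * phiNegTwo (τ, z) ^ 3) = E₆ τ * v ^ 3 := by
      field_simp
    rwa [Units.val_mk0, e1, e2, e3, ← update_vec_zero 0] at hz
  have step2 (y : ℂ) (hy : y ≠ 0) (u x : ℂ) : MvPolynomial.eval ![u, x, y] P = 0 := by
    have key := P.eval_update_eq_zero_of_infinite ![u, 0, y] 1 ?_ x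
    · rwa [update_vec_one] at key
    intro hfin
    -- If only finitely many x were roots, then x³ / y² would take finitely many values. But
    -- choosing v with E₆ v³ = y makes x = E₄ v² a root with x³ / y² = E₄³ / E₆².
    refine infinite_eisenstein_ratio ((hfin.image fun x => x ^ 3 / y ^ 2).subset ?_)
    rintro _ ⟨τ, ⟨h4, h6⟩, rfl⟩
    obtain ⟨v, hv⟩ := IsAlgClosed.exists_pow_nat_eq (y / E₆ τ) (n := 3) (by norm_num)
    have hv0 : v ≠ 0 := by
      rintro rfl
      exact div_ne_zero hy h6 (by simpa using hv.symm)
    have hv' : E₆ τ * v ^ 3 = y := by rw [hv]; field_simp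
    refine ⟨E₄ τ * v ^ 2, ?_, ?_⟩
    · have := step1 τ v hv0 u
      rwa [hv', ← update_vec_one _ 0] at this
    · simp only [← hv']
      field_simp
  refine MvPolynomial.funext fun w => ?_
  have key := P.eval_update_eq_zero_of_infinite ![w 0, w 1, 0] 2 ?_ (w 2)
  · rw [map_zero, ← key]
    congr 2
    ext j
    fin_cases j <;> rfl
  · refine (Set.finite_singleton (0 : ℂ)).infinite_compl.mono fun y hy => ?_
    have := step2 y hy (w 0) (w 1)
    rwa [← update_vec_two _ _ 0] at this

end

theorem proposition4p1 :
    ∃ (φ₁ : weakJacobiForm 0 1) (φ₂ : weakJacobiForm 0 2) (φ₃ : weakJacobiForm 0 3),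
      AlgebraicIndependent ℂ
        ![WeakJacobiRing.of 1 φ₁, WeakJacobiRing.of 2 φ₂, WeakJacobiRing.of 3 φ₃] ∧
      Algebra.adjoin ℂ
        {WeakJacobiRing.of 1 φ₁, WeakJacobiRing.of 2 φ₂, WeakJacobiRing.of 3 φ₃} =
          (⊤ : Subalgebra ℂ WeakJacobiRing) := by
  refine ⟨⟨_, .phiZero⟩, ⟨_, .E₄_mul_phiNegTwo_sq⟩, ⟨_, .E₆_mul_phiNegTwo_cube⟩,
    algebraicIndependent_iff.mpr fun P hP => ?_, eq_top_of_mem_degreePart ?_ ?_ ?_⟩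
  · refine mvPolynomial_eq_zero_of_eval_phi fun τ z t => ?_
    -- The weight t ^ m on degree m is the extra parameter that the direct sum provides beyond the
    -- values of the functions.
    have h := congrArg (evalAlgHom (τ, z) t) hP
    rw [map_zero, ← AlgHom.comp_apply, MvPolynomial.comp_aeval] at h
    rw [← h, ← MvPolynomial.coe_aeval_eq_eval]
    change MvPolynomial.aeval _ P = _
    congr 2
    ext j
    fin_cases j
    · exact ((evalAlgHom_of (τ, z) t 1 ⟨_, .phiZero⟩).trans
        (congrArg (· * phiZero (τ, z)) (zpow_one _))).symm
    · exact ((evalAlgHom_of (τ, z) t 2 ⟨_, .E₄_mul_phiNegTwo_sq⟩).trans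
        (congrArg (· * (ModularForm.E₄ τ * phiNegTwo (τ, z) ^ 2)) (zpow_ofNat _ 2))).symm
    · exact ((evalAlgHom_of (τ, z) t 3 ⟨_, .E₆_mul_phiNegTwo_cube⟩).trans
        (congrArg (· * (ModularForm.E₆ τ * phiNegTwo (τ, z) ^ 3)) (zpow_ofNat _ 3))).symm
  · exact (coe_mem_degreePart (φ := ⟨_, .phiZero⟩)).mpr (Algebra.subset_adjoin (Or.inl rfl))
  · exact (coe_mem_degreePart (φ := ⟨_, .E₄_mul_phiNegTwo_sq⟩)).mpr
      (Algebra.subset_adjoin (Or.inr (Or.inl rfl)))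
  · exact (coe_mem_degreePart (φ := ⟨_, .E₆_mul_phiNegTwo_cube⟩)).mpr
      (Algebra.subset_adjoin (Or.inr (Or.inr rfl)))
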